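/- Let $L_{2\pi}$ be the space of all $2\pi$-periodic functions $f:\mathbb{R}\to\mathbb{C}$ integrable on $[-\pi,\pi]$, with norm $\|f\|_L=\int_{-\pi}^{\pi}|f(x)|\,dx$. For $f\in L_{2\pi}$ let $\hat f(n)=\frac1{2\pi}\int_{-\pi}^{\pi}f(x)e^{-inx}\,dx$ $(n\in\mathbb{Z})$ and $S_n(f,x)=\sum_{k=-n}^{n}\hat f(k)e^{ikx}$. Write $[x]$ for the integer part of $x$. A sequence $\mathbf c=\{c_n\}_{n\ge 0}$ of complex numbers is said to belong to $MVBVS$ if there is $\theta_1\in[0,\pi/2)$ such that $c_n\in K(\theta_1):=\{z\in\mathbb{C}:|\arg z|\le\theta_1\}$ for all $n\ge0$ (where $0\in K(\theta_1)$), and there are a real number $\lambda\ge2$ and a constant $C(\mathbf c)>0$ such that $$\sum_{k=m}^{2m}|c_{k+1}-c_k|\le C(\mathbf c)\,\frac1m\sum_{k=[\lambda^{-1}m]}^{[\lambda m]}|c_k|\qquad\text{for all } m=1,2,\ldots.$$ Theorem 1. Let $f\in L_{2\pi}$ be a complex-valued function such that $\{\hat f(n)\}_{n=0}^{\infty}\in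 MVBVS$ and $$\lim_{\mu\to1^+}\limsup_{n\to\infty}\sum_{k=n}^{[\mu n]}\bigl|\Delta\hat f(k)-\Delta\hat f(-k)\bigr|\log k=0,$$ where $\Delta\hat f(k)=\hat f(k+1)-\hat f(k)$ and $\Delta\hat f(-k)=\hat f(-k-1)-\hat f(-k)$ for $k\ge0$. Then $$\lim_{n\to\infty}\|f-S_n(f)\|_L=0\quad\text{if and only if}\quad\lim_{|n|\to\infty}\hat f(n)\log|n|=0,$$ the last limit being taken over all integers $n$ (both $n\to+\infty$ and $n\to-\infty$). -/

import Mathlib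

open Filter Topology

/-- The sector `K(θ) = {z : |arg z| ≤ θ}` of the complex plane; as `Complex.arg 0 = 0`,
it contains the origin when `0 ≤ θ`. -/
def sectorK (θ : ℝ) : Set ℂ := {z | |Complex.arg z| ≤ θ}

/-- Mean value bounded variation sequences (in complex sense). -/
def MVBVS : Set (ℕ → ℂ) :=
  {c | (∃ θ : ℝ, 0 ≤ θ ∧ θ < Real.pi / 2 ∧ ∀ n : ℕ, c n ∈ sectorK θ) ∧
    ∃ lam : ℝ, 2 ≤ lam ∧ ∃ C : ℝ, 0 < C ∧ ∀ m : ℕ, 1 ≤ m →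
      ∑ k ∈ Finset.Icc m (2 * m), ‖c (k + 1) - c k‖ ≤
        C * (1 / (m : ℝ)) * ∑ k ∈ Finset.Icc ⌊lam⁻¹ * (m : ℝ)⌋₊ ⌊lam * (m : ℝ)⌋₊, ‖c k‖}

/-- Fourier coefficient `(1 / 2π) ∫_{-π}^{π} f(x) e^{-inx} dx`. -/
noncomputable def fcoeff (f : ℝ → ℂ) (n : ℤ) : ℂ :=
  fourierCoeffOn (neg_lt_self Real.pi_pos) f n

/-- The `n`-th symmetric partial sum `∑_{k=-n}^{n} f̂(k) e^{ikx}` of the Fourier series. -/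
noncomputable def fourierPartialSum (f : ℝ → ℂ) (n : ℕ) (x : ℝ) : ℂ :=
  ∑ k ∈ Finset.Icc (-(n : ℤ)) (n : ℤ),
    fcoeff f k * Complex.exp (Complex.I * (k : ℂ) * (x : ℂ))

/-- The norm `∫_{-π}^{π} |g(x)| dx`. -/
noncomputable def normL (g : ℝ → ℂ) : ℝ := ∫ x in (-Real.pi)..Real.pi, ‖g x‖

/-- `Δf̂(k) = f̂(k+1) - f̂(k)` for `k ≥ 0`. -/
noncomputable def deltaPos (f : ℝ → ℂ) (k : ℕ) : ℂ :=
  fcoeff f ((k : ℤ) + 1) - fcoeff f (k : ℤ)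

/-- `Δf̂(-k) = f̂(-k-1) - f̂(-k)` for `k ≥ 0`. -/
noncomputable def deltaNeg (f : ℝ → ℂ) (k : ℕ) : ℂ :=
  fcoeff f (-(k : ℤ) - 1) - fcoeff f (-(k : ℤ))

/-! Write c_k for the coefficients on one side of the spectrum.

Decay implies convergence. Abel summation bounds the L¹ norm of a block S_j - S_n by (end
coefficients + variation over the block) times log j, because exponential sums of length at most N
share a majorant with integral O(log N). Under log-decay, mean value bounded variation makes the
positive side's variation over [m, 2m] o(1/log m); the hypothesis on differences then makes the
negative side's small over [n, μn] for μ near 1. So S_j - S_n is small for n ≤ j < μn. Averaging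
over these j, as in de la Vallée Poussin means, and applying Fejér's theorem in L¹ gives S_n → f
(`tendsto_normL_sub_fourierPartialSum`).

Convergence implies decay. The sums ∑ sin(kx)/k are uniformly bounded. Testing f - S_n against them,
modulated to frequency ±n, gives |∑ c_{n+i}/i| ≤ const · ‖f - S_n‖ on either side
(`norm_sum_sideCoeff_div_le`). On the positive side the sector condition puts absolute values inside
the sum; averaging over n recovers a logarithm (`sum_norm_mul_log_le_sum_hilbertSum`), and bounded
variation passes from averages to single coefficients. The negative side has no sector condition,
but its variation is now known to be log-small, so c_{n+i} may be replaced by c_n and the harmonic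
sum supplies log n (`tendsto_norm_mul_log_of_smallLogVariation`). -/

/-! ### Exponentials and their geometric sums. -/

/-- The trigonometric monomial `x ↦ e^{inx}`. -/
noncomputable def trigMon (n : ℤ) (x : ℝ) : ℂ := Complex.exp (Complex.I * (n : ℂ) * (x : ℂ))

lemma norm_trigMon (n : ℤ) (x : ℝ) : ‖trigMon n x‖ = 1 := by
  have : Complex.I * (n : ℂ) * (x : ℂ) = Complex.I * ((n * x : ℝ) : ℂ) := by push_cast; ring
  rw [trigMon, this, Complex.norm_exp_I_mul_ofReal]

@[fun_prop] lemma continuous_trigMon (n : ℤ) : Continuous (trigMon n) := by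
  unfold trigMon; fun_prop

lemma trigMon_zero (x : ℝ) : trigMon 0 x = 1 := by simp [trigMon]

lemma trigMon_add (m n : ℤ) (x : ℝ) : trigMon (m + n) x = trigMon m x * trigMon n x := by
  rw [trigMon, trigMon, trigMon, ← Complex.exp_add]; push_cast; ring_nf

lemma trigMon_sub_arg (n : ℤ) (x t : ℝ) : trigMon n (x - t) = trigMon n x * trigMon (-n) t := by
  rw [trigMon, trigMon, trigMon, ← Complex.exp_add]; push_cast; ring_nf

lemma trigMon_natCast (n : ℕ) (x : ℝ) : trigMon n x = trigMon 1 x ^ n := by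
  rw [trigMon, trigMon, ← Complex.exp_nat_mul]; push_cast; ring_nf

lemma trigMon_neg (n : ℤ) (x : ℝ) : trigMon (-n) x = starRingEnd ℂ (trigMon n x) := by
  rw [trigMon, trigMon, ← Complex.exp_conj]; simp

lemma trigMon_periodic (n : ℤ) : Function.Periodic (trigMon n) (2 * Real.pi) := by
  intro x
  rw [trigMon, trigMon, Complex.exp_eq_exp_iff_exists_int]
  exact ⟨n, by push_cast; ring⟩

lemma trigMon_im (n : ℤ) (x : ℝ) : (trigMon n x).im = Real.sin (n * x) := by
  have : Complex.I * (n : ℂ) * (x : ℂ) = ((n * x : ℝ) : ℂ) * Complex.I := by push_cast; ring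
  rw [trigMon, this, Complex.exp_ofReal_mul_I_im]

lemma norm_trigMon_one_sub_one {x : ℝ} (hx : |x| ≤ Real.pi) :
    2 / Real.pi * |x| ≤ ‖trigMon 1 x - 1‖ := by
  have h := Complex.norm_exp_I_mul_ofReal_sub_one x
  have h1 : trigMon 1 x = Complex.exp (Complex.I * x) := by simp [trigMon]
  rw [h1, h, norm_mul, Real.norm_eq_abs, Real.norm_eq_abs]
  have h2 := Real.mul_abs_le_abs_sin (x := x / 2) (by rw [abs_div]; norm_num; linarith)
  rw [abs_div] at h2
  norm_num at h2 ⊢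
  calc 2 / Real.pi * |x| = 2 * (|x| / Real.pi) := by ring
    _ ≤ _ := by gcongr

lemma norm_sum_trigMon_mul (a : ℤ) (n : ℕ) (x : ℝ) :
    ‖∑ i ∈ Finset.range n, trigMon (a + i) x‖ * ‖trigMon 1 x - 1‖ ≤ 2 := by
  have h : ∑ i ∈ Finset.range n, trigMon (a + i) x
      = trigMon a x * ∑ i ∈ Finset.range n, trigMon 1 x ^ i := by
    rw [Finset.mul_sum]
    exact Finset.sum_congr rfl fun i _ => by rw [trigMon_add, trigMon_natCast]
  rw [h, ← norm_mul, mul_assoc, geom_sum_mul, norm_mul, norm_trigMon, one_mul]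
  refine (norm_sub_le _ _).trans ?_
  rw [norm_pow, norm_trigMon]; norm_num

lemma norm_sum_trigMon_mul_abs_le (a : ℤ) (n : ℕ) {x : ℝ} (hx : |x| ≤ Real.pi) :
    ‖∑ i ∈ Finset.range n, trigMon (a + i) x‖ * |x| ≤ Real.pi := by
  have h1 := norm_sum_trigMon_mul a n x
  have h2 := mul_le_mul_of_nonneg_left (norm_trigMon_one_sub_one hx)
    (norm_nonneg (∑ i ∈ Finset.range n, trigMon (a + i) x))
  have h3 := h2.trans h1
  have hpi := Real.pi_pos
  have h4 : ‖∑ i ∈ Finset.range n, trigMon (a + i) x‖ * (2 / Real.pi * |x|)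
    = 2 / Real.pi * (‖∑ i ∈ Finset.range n, trigMon (a + i) x‖ * |x|) := by ring
  rw [h4, div_mul_eq_mul_div, div_le_iff₀ hpi] at h3
  linarith

lemma norm_sum_trigMon_le (a : ℤ) (n : ℕ) (x : ℝ) :
    ‖∑ i ∈ Finset.range n, trigMon (a + i) x‖ ≤ n := by
  refine (norm_sum_le _ _).trans ?_
  simp [norm_trigMon]

/-! ### Abel summation and bounded sine polynomials. -/

/-- Abel's inequality. -/
lemma norm_sum_range_mul_le (b z : ℕ → ℂ) (n : ℕ) {B : ℝ}
    (hB : ∀ m ≤ n, ‖∑ i ∈ Finset.range m, z i‖ ≤ B) :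
    ‖∑ i ∈ Finset.range n, b i * z i‖
      ≤ (‖b (n - 1)‖ + ∑ i ∈ Finset.range (n - 1), ‖b (i + 1) - b i‖) * B := by
  have h := Finset.sum_range_by_parts b z n
  simp only [smul_eq_mul] at h
  rw [h, add_mul, Finset.sum_mul]
  refine (norm_sub_le _ _).trans (add_le_add ?_ ((norm_sum_le _ _).trans ?_))
  · rw [norm_mul]; exact mul_le_mul_of_nonneg_left (hB n le_rfl) (norm_nonneg _)
  · refine Finset.sum_le_sum fun i hi => ?_
    rw [norm_mul]
    refine mul_le_mul_of_nonneg_left (hB _ ?_) (norm_nonneg _)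
    have := Finset.mem_range.1 hi; omega

/-- The sums `∑_{k ≤ N} sin(kx)/k` are uniformly bounded. -/
lemma abs_sum_sin_div_le (N : ℕ) {x : ℝ} (hx : |x| ≤ Real.pi) :
    |∑ i ∈ Finset.range N, Real.sin ((i + 1) * x) / (i + 1)| ≤ 1 + Real.pi := by
  have hpi := Real.pi_pos
  rcases eq_or_ne x 0 with rfl | hx0
  · simp; positivity
  have hxp : 0 < |x| := abs_pos.2 hx0
  -- Split at k ≈ 1/|x|: before it each term is at most |x|; after it Abel's inequality gains the
  -- factor 1/(m+1) ≤ |x| against π/|x|.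
  set m : ℕ := ⌊1 / |x|⌋₊ with hm
  have head : ∀ M : ℕ, M ≤ m →
      |∑ i ∈ Finset.range M, Real.sin ((i + 1) * x) / (i + 1)| ≤ 1 := by
    intro M hM
    have hMx : (M : ℝ) * |x| ≤ 1 := by
      have h1 : (M : ℝ) ≤ 1 / |x| :=
        le_trans (by exact_mod_cast hM) (Nat.floor_le (by positivity))
      rwa [le_div_iff₀ hxp] at h1
    refine (Finset.abs_sum_le_sum_abs _ _).trans (le_trans (Finset.sum_le_sum (g := fun _ => |x|)
      fun i _ => ?_) (by simpa using hMx))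
    have hi : (0 : ℝ) < i + 1 := by positivity
    rw [abs_div, abs_of_pos hi, div_le_iff₀ hi]
    refine Real.abs_sin_le_abs.trans ?_
    rw [abs_mul, abs_of_pos hi, mul_comm]
  rcases le_total N m with h | h
  · linarith [head N h]
  obtain ⟨n, rfl⟩ := Nat.exists_eq_add_of_le h
  rw [Finset.sum_range_add]
  refine (abs_add_le _ _).trans (add_le_add (head m le_rfl) ?_)
  set b : ℕ → ℂ := fun i => ((1 / ((m : ℝ) + i + 1) : ℝ) : ℂ) with hb
  have hre : ∑ i ∈ Finset.range n, Real.sin (((m + i : ℕ) + 1) * x) / ((m + i : ℕ) + 1)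
      = (∑ i ∈ Finset.range n, b i * trigMon (((m : ℤ) + 1) + i) x).im := by
    rw [Complex.im_sum]
    refine Finset.sum_congr rfl fun i _ => ?_
    rw [hb, Complex.im_ofReal_mul, trigMon_im]
    push_cast; ring_nf
  rw [hre]
  refine (Complex.abs_im_le_norm _).trans ?_
  have hA := norm_sum_range_mul_le b (fun i => trigMon (((m : ℤ) + 1) + i) x) n
    (B := Real.pi / |x|) (fun k _ => by
      rw [le_div_iff₀ hxp]; exact norm_sum_trigMon_mul_abs_le _ _ hx)
  refine hA.trans ?_
  have hbn : ∀ i, ‖b i‖ = 1 / ((m : ℝ) + i + 1) := fun i => by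
    rw [hb, Complex.norm_real, Real.norm_eq_abs, abs_of_nonneg (by positivity)]
  have hbd : ∀ i, ‖b (i + 1) - b i‖ = 1 / ((m : ℝ) + i + 1) - 1 / ((m : ℝ) + (i + 1 : ℕ) + 1) := by
    intro i
    rw [hb, ← Complex.ofReal_sub, Complex.norm_real, Real.norm_eq_abs, abs_sub_comm, abs_of_nonneg]
    rw [sub_nonneg]
    apply one_div_le_one_div_of_le (by positivity)
    push_cast; linarith
  rw [hbn, Finset.sum_congr rfl fun i _ => hbd i,
    Finset.sum_range_sub' (fun i : ℕ => 1 / ((m : ℝ) + i + 1))]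
  have h2 : 1 / ((m : ℝ) + 1) ≤ |x| := by
    rw [div_le_iff₀ (by positivity), mul_comm, ← div_le_iff₀ hxp]
    exact (Nat.lt_floor_add_one _).le
  calc _ = 1 / ((m : ℝ) + 1) * (Real.pi / |x|) := by push_cast; ring
    _ ≤ |x| * (Real.pi / |x|) := by gcongr
    _ = Real.pi := by field_simp

/-! ### An L¹ majorant of logarithmic size. -/

/-- A common integrable majorant of all exponential sums with at most `N` terms. -/
noncomputable def kernelBound (N : ℕ) (x : ℝ) : ℝ := (1 + Real.pi) * (N / (1 + N * |x|))

lemma continuous_kernelBound (N : ℕ) : Continuous (kernelBound N) := by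
  unfold kernelBound
  refine continuous_const.mul (continuous_const.div (by fun_prop) fun x => ?_)
  positivity

/-- Adds the trivial bound N to N times the bound π for |x| times the sum. Uniformity in n and a
lets Abel's inequality be applied pointwise and integrated once. -/
lemma norm_sum_trigMon_le_kernelBound (a : ℤ) {n N : ℕ} (hn : n ≤ N) {x : ℝ}
    (hx : |x| ≤ Real.pi) :
    ‖∑ i ∈ Finset.range n, trigMon (a + i) x‖ ≤ kernelBound N x := by
  have h1 := norm_sum_trigMon_mul_abs_le a n hx
  have h2 := norm_sum_trigMon_le a n x
  have h3 : (n : ℝ) ≤ N := by exact_mod_cast hn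
  rw [kernelBound, ← mul_div_assoc, le_div_iff₀ (by positivity)]
  nlinarith [mul_le_mul_of_nonneg_left h1 (Nat.cast_nonneg (α := ℝ) N)]

lemma integral_kernelBound (N : ℕ) :
    ∫ x in (-Real.pi)..Real.pi, kernelBound N x
      = 2 * (1 + Real.pi) * Real.log (1 + N * Real.pi) := by
  have hpi := Real.pi_pos
  have hpos : ∫ x in (0 : ℝ)..Real.pi, kernelBound N x
      = (1 + Real.pi) * Real.log (1 + N * Real.pi) := by
    have key : ∀ x ∈ Set.uIcc 0 Real.pi,
        HasDerivAt (fun x => (1 + Real.pi) * Real.log (1 + N * x))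
          ((1 + Real.pi) * (N / (1 + N * x))) x := by
      intro x hx
      rw [Set.uIcc_of_le hpi.le] at hx
      have h0 : (1 + N * x : ℝ) ≠ 0 := by have := hx.1; positivity
      have h1 : HasDerivAt (fun x : ℝ => 1 + N * x) N x := by
        simpa using ((hasDerivAt_id x).const_mul (N : ℝ)).const_add 1
      exact (h1.log h0).const_mul _
    have hc : ∫ x in (0 : ℝ)..Real.pi, kernelBound N x
        = ∫ x in (0 : ℝ)..Real.pi, (1 + Real.pi) * (N / (1 + N * x)) := by
      refine intervalIntegral.integral_congr fun x hx => ?_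
      rw [Set.uIcc_of_le hpi.le] at hx
      simp only [kernelBound, abs_of_nonneg hx.1]
    rw [hc, intervalIntegral.integral_eq_sub_of_hasDerivAt key]
    · simp
    · apply ContinuousOn.intervalIntegrable
      rw [Set.uIcc_of_le hpi.le]
      refine continuousOn_const.mul (continuousOn_const.div (by fun_prop) fun x hx => ?_)
      have := hx.1; positivity
  have hneg : ∫ x in (-Real.pi)..0, kernelBound N x = ∫ x in (0 : ℝ)..Real.pi, kernelBound N x := by
    have h := intervalIntegral.integral_comp_neg (a := 0) (b := Real.pi) (kernelBound N)
    rw [neg_zero] at h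
    rw [← h]
    exact intervalIntegral.integral_congr fun x _ => by simp [kernelBound]
  rw [← intervalIntegral.integral_add_adjacent_intervals
    ((continuous_kernelBound N).intervalIntegrable _ _)
    ((continuous_kernelBound N).intervalIntegrable _ _), hneg, hpos]
  ring

lemma integral_kernelBound_le {N : ℕ} (hN : 2 ≤ N) :
    ∫ x in (-Real.pi)..Real.pi, kernelBound N x ≤ 8 * (1 + Real.pi) * Real.log N := by
  rw [integral_kernelBound]
  have hN' : (2 : ℝ) ≤ N := by exact_mod_cast hN
  have hpi := Real.pi_pos
  have h4 := Real.pi_lt_four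
  have h : Real.log (1 + N * Real.pi) ≤ 4 * Real.log N := by
    rw [show (4 : ℝ) * Real.log N = Real.log ((N : ℝ) ^ 4) by simp]
    refine Real.log_le_log (by positivity) ?_
    have : (8 : ℝ) ≤ N ^ 3 := by
      calc (8 : ℝ) = 2 ^ 3 := by norm_num
        _ ≤ _ := by gcongr
    nlinarith
  nlinarith

/-! ### Fourier coefficients and the L¹ norm. -/

open MeasureTheory intervalIntegral in
lemma integral_trigMon (n : ℤ) :
    ∫ x in (-Real.pi)..Real.pi, trigMon n x = if n = 0 then (2 * Real.pi : ℂ) else 0 := by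
  split_ifs with h
  · subst h
    simp [trigMon_zero]; ring
  · have h0 : Complex.I * (n : ℂ) ≠ 0 := mul_ne_zero Complex.I_ne_zero (by exact_mod_cast h)
    have := integral_exp_mul_complex (a := -Real.pi) (b := Real.pi) h0
    have hp := trigMon_periodic n (-Real.pi)
    unfold trigMon at hp ⊢
    rw [this, div_eq_zero_iff, sub_eq_zero]
    left
    rw [← hp]; congr 3; ring

lemma fcoeff_eq (f : ℝ → ℂ) (n : ℤ) :
    fcoeff f n = (1 / (2 * Real.pi) : ℂ) * ∫ x in (-Real.pi)..Real.pi, trigMon (-n) x * f x := by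
  rw [fcoeff, fourierCoeffOn_eq_integral, Complex.real_smul]
  congr 1
  · push_cast; ring
  · refine intervalIntegral.integral_congr fun x _ => ?_
    simp only [smul_eq_mul]
    rw [fourier_coe_apply, trigMon]
    congr 2
    have : (Real.pi : ℂ) ≠ 0 := by exact_mod_cast Real.pi_ne_zero
    push_cast
    field_simp
    ring

lemma fourierPartialSum_eq (f : ℝ → ℂ) (n : ℕ) (x : ℝ) :
    fourierPartialSum f n x = ∑ k ∈ Finset.Icc (-(n : ℤ)) (n : ℤ), fcoeff f k * trigMon k x := rfl

@[fun_prop] lemma continuous_fourierPartialSum (f : ℝ → ℂ) (n : ℕ) :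
    Continuous (fourierPartialSum f n) := by
  unfold fourierPartialSum; fun_prop

/-- Integrability on `[-π, π]`. -/
abbrev L1Int (f : ℝ → ℂ) : Prop :=
  IntervalIntegrable f MeasureTheory.volume (-Real.pi) Real.pi

lemma L1Int.trigMon_mul {f : ℝ → ℂ} (hf : L1Int f) (n : ℤ) : L1Int (fun x => trigMon n x * f x) :=
  IntervalIntegrable.continuousOn_mul hf (continuous_trigMon n).continuousOn

lemma Continuous.l1Int {f : ℝ → ℂ} (hf : Continuous f) : L1Int f := hf.intervalIntegrable _ _

lemma fcoeff_sub {f g : ℝ → ℂ} (hf : L1Int f) (hg : L1Int g) (n : ℤ) :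
    fcoeff (fun x => f x - g x) n = fcoeff f n - fcoeff g n := by
  simp only [fcoeff_eq, mul_sub]
  rw [intervalIntegral.integral_sub (hf.trigMon_mul _) (hg.trigMon_mul _), mul_sub]

lemma fcoeff_sum_trigMon (s : Finset ℤ) (c : ℤ → ℂ) (n : ℤ) :
    fcoeff (fun x => ∑ k ∈ s, c k * trigMon k x) n = if n ∈ s then c n else 0 := by
  have hpi : (Real.pi : ℂ) ≠ 0 := by exact_mod_cast Real.pi_ne_zero
  rw [fcoeff_eq]
  simp only [Finset.mul_sum]
  rw [intervalIntegral.integral_finsetSum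
    (fun k _ => Continuous.intervalIntegrable (by fun_prop) _ _)]
  have : ∀ k ∈ s, ∫ x in (-Real.pi)..Real.pi, trigMon (-n) x * (c k * trigMon k x)
      = if n = k then 2 * Real.pi * c k else 0 := by
    intro k _
    have h1 : ∀ x, trigMon (-n) x * (c k * trigMon k x) = c k * trigMon (-n + k) x := fun x => by
      rw [trigMon_add]; ring
    simp only [h1]
    rw [intervalIntegral.integral_const_mul, integral_trigMon]
    have : -n + k = 0 ↔ n = k := by omega
    simp only [this, mul_ite, mul_zero]
    congr 1; ring
  rw [Finset.sum_congr rfl this, Finset.sum_ite_eq]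
  split_ifs
  · field_simp
  · simp

lemma fcoeff_fourierPartialSum (f : ℝ → ℂ) (n : ℕ) (k : ℤ) :
    fcoeff (fourierPartialSum f n) k
      = if k ∈ Finset.Icc (-(n : ℤ)) (n : ℤ) then fcoeff f k else 0 :=
  fcoeff_sum_trigMon _ _ _

lemma normL_nonneg (f : ℝ → ℂ) : 0 ≤ normL f :=
  intervalIntegral.integral_nonneg (by linarith [Real.pi_pos]) fun _ _ => norm_nonneg _

lemma normL_add_le {f g : ℝ → ℂ} (hf : L1Int f) (hg : L1Int g) :
    normL (fun x => f x + g x) ≤ normL f + normL g := by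
  unfold normL
  rw [← intervalIntegral.integral_add hf.norm hg.norm]
  exact intervalIntegral.integral_mono_on (by linarith [Real.pi_pos]) (hf.add hg).norm
    (hf.norm.add hg.norm) fun x _ => norm_add_le _ _

lemma normL_sub_le {f g : ℝ → ℂ} (hf : L1Int f) (hg : L1Int g) :
    normL (fun x => f x - g x) ≤ normL f + normL g := by
  have := normL_add_le hf hg.neg
  simpa [normL, sub_eq_add_neg] using this

lemma normL_const_mul (c : ℂ) (f : ℝ → ℂ) : normL (fun x => c * f x) = ‖c‖ * normL f := by
  simp [normL]

lemma normL_sum_le {ι : Type*} (s : Finset ι) {f : ι → ℝ → ℂ} (hf : ∀ i ∈ s, L1Int (f i)) :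
    normL (fun x => ∑ i ∈ s, f i x) ≤ ∑ i ∈ s, normL (f i) := by
  unfold normL
  rw [← intervalIntegral.integral_finsetSum fun i hi => (hf i hi).norm]
  refine intervalIntegral.integral_mono_on (by linarith [Real.pi_pos]) ?_ ?_
    fun x _ => norm_sum_le _ _
  · have := (IntervalIntegrable.sum s hf).norm
    simpa using this
  · have := IntervalIntegrable.sum s fun i hi => (hf i hi).norm
    have e : (fun x => ∑ i ∈ s, ‖f i x‖) = ∑ i ∈ s, fun x => ‖f i x‖ := by ext x; simp
    rwa [e]

lemma normL_le_of_le_kernelBound {g : ℝ → ℂ} (hg : L1Int g) {A : ℝ} {N : ℕ} (hA : 0 ≤ A)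
    (hN : 2 ≤ N) (h : ∀ x, |x| ≤ Real.pi → ‖g x‖ ≤ A * kernelBound N x) :
    normL g ≤ A * (8 * (1 + Real.pi) * Real.log N) := by
  have hpi := Real.pi_pos
  calc normL g ≤ ∫ x in (-Real.pi)..Real.pi, A * kernelBound N x :=
        intervalIntegral.integral_mono_on (by linarith) hg.norm
          (((continuous_kernelBound N).const_mul A).intervalIntegrable _ _)
          fun x hx => h x (abs_le.2 hx)
    _ = A * ∫ x in (-Real.pi)..Real.pi, kernelBound N x := intervalIntegral.integral_const_mul _ _
    _ ≤ _ := mul_le_mul_of_nonneg_left (integral_kernelBound_le hN) hA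

/-! ### Testing against bounded sine polynomials. -/

/-- Testing against the bounded polynomials `∑ sin(kx)/k` bounds discrete Hilbert-type sums of
Fourier coefficients by the `L¹` norm. -/
lemma norm_sum_fcoeff_sub_div_le {g : ℝ → ℂ} (hg : L1Int g) (p : ℤ) (N : ℕ) :
    ‖∑ i ∈ Finset.range N, (fcoeff g (p + (i + 1)) - fcoeff g (p - (i + 1))) / (i + 1 : ℂ)‖
      ≤ (1 + Real.pi) / Real.pi * normL g := by
  have hpi := Real.pi_pos
  have hpi' : (Real.pi : ℂ) ≠ 0 := by exact_mod_cast Real.pi_ne_zero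
  set s : ℝ → ℝ := fun x => ∑ i ∈ Finset.range N, Real.sin ((i + 1) * x) / (i + 1) with hs
  -- Pairing frequencies symmetric about p gives e^{-i(p+k)x} - e^{-i(p-k)x} = -2i e^{-ipx} sin(kx).
  have hid : ∑ i ∈ Finset.range N, (fcoeff g (p + (i + 1)) - fcoeff g (p - (i + 1))) / (i + 1 : ℂ)
      = (-(2 * Complex.I) / (2 * Real.pi)) *
        ∫ x in (-Real.pi)..Real.pi, (trigMon (-p) x * s x) * g x := by
    have hterm : ∀ i ∈ Finset.range N,
        (fcoeff g (p + (i + 1)) - fcoeff g (p - (i + 1))) / (i + 1 : ℂ)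
        = (-(2 * Complex.I) / (2 * Real.pi)) * ∫ x in (-Real.pi)..Real.pi,
          (trigMon (-p) x * ((Real.sin ((i + 1) * x) / (i + 1) : ℝ) : ℂ)) * g x := by
      intro i _
      have hi : (i + 1 : ℂ) ≠ 0 := by exact_mod_cast Nat.succ_ne_zero i
      rw [fcoeff_eq, fcoeff_eq, ← mul_sub, ← intervalIntegral.integral_sub (hg.trigMon_mul _)
        (hg.trigMon_mul _), mul_div_assoc, ← intervalIntegral.integral_div,
        ← intervalIntegral.integral_const_mul, ← intervalIntegral.integral_const_mul]
      refine intervalIntegral.integral_congr fun x _ => ?_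
      have e1 : trigMon (-(p + (i + 1))) x = trigMon (-p) x * trigMon (-((i : ℤ) + 1)) x := by
        rw [← trigMon_add]; congr 1; ring
      have e2 : trigMon (-(p - (i + 1))) x = trigMon (-p) x * trigMon ((i : ℤ) + 1) x := by
        rw [← trigMon_add]; congr 1; ring
      have e3 : trigMon (-((i : ℤ) + 1)) x - trigMon ((i : ℤ) + 1) x
          = -(2 * Complex.I) * (Real.sin ((i + 1) * x) : ℝ) := by
        have hh := trigMon_im ((i : ℤ) + 1) x
        push_cast at hh
        rw [trigMon_neg, ← hh]
        apply Complex.ext <;> simp; ring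
      simp only [e1, e2]
      rw [← sub_mul, ← mul_sub, e3]
      push_cast
      field_simp
    rw [Finset.sum_congr rfl hterm, ← Finset.mul_sum, ← intervalIntegral.integral_finsetSum]
    · congr 1
      refine intervalIntegral.integral_congr fun x _ => ?_
      simp only [hs]
      rw [← Finset.sum_mul, ← Finset.mul_sum, Complex.ofReal_sum]
    · intro i _
      exact IntervalIntegrable.continuousOn_mul hg
        (Continuous.continuousOn (by fun_prop))
  rw [hid, norm_mul]
  have h1 : ‖(-(2 * Complex.I) / (2 * Real.pi) : ℂ)‖ = 1 / Real.pi := by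
    rw [norm_div, norm_neg, norm_mul, norm_mul, Complex.norm_I, Complex.norm_real,
      Real.norm_eq_abs, abs_of_pos hpi, Complex.norm_two]
    field_simp
  have h2 : ‖∫ x in (-Real.pi)..Real.pi, (trigMon (-p) x * s x) * g x‖
      ≤ (1 + Real.pi) * normL g := by
    rw [normL, ← intervalIntegral.integral_const_mul]
    refine intervalIntegral.norm_integral_le_of_norm_le (by linarith) ?_
      (hg.norm.const_mul _)
    refine Filter.Eventually.of_forall fun x hx => ?_
    rw [norm_mul, norm_mul, norm_trigMon, one_mul, Complex.norm_real]
    exact mul_le_mul_of_nonneg_right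
      (abs_sum_sin_div_le N (abs_le.2 ⟨hx.1.le, hx.2⟩)) (norm_nonneg _)
  rw [h1]
  calc _ ≤ 1 / Real.pi * ((1 + Real.pi) * normL g) := by gcongr
    _ = _ := by ring

/-! ### The Fejér kernel and Fejér's theorem in L¹. -/

/-- The Dirichlet kernel. -/
noncomputable def dirichletKer (n : ℕ) (x : ℝ) : ℂ :=
  ∑ k ∈ Finset.Icc (-(n : ℤ)) (n : ℤ), trigMon k x

/-- The sum of the first `M` Dirichlet kernels. -/
noncomputable def fejerKer (M : ℕ) (x : ℝ) : ℂ := ∑ j ∈ Finset.range M, dirichletKer j x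

@[fun_prop] lemma continuous_dirichletKer (n : ℕ) : Continuous (dirichletKer n) := by
  unfold dirichletKer; fun_prop

@[fun_prop] lemma continuous_fejerKer (M : ℕ) : Continuous (fejerKer M) := by
  unfold fejerKer; fun_prop

lemma fejerKer_periodic (M : ℕ) : Function.Periodic (fejerKer M) (2 * Real.pi) := by
  intro x
  unfold fejerKer dirichletKer
  exact Finset.sum_congr rfl fun j _ => Finset.sum_congr rfl fun k _ => trigMon_periodic k x

lemma dirichletKer_eq (n : ℕ) (x : ℝ) : dirichletKer n x
    = 1 + ∑ i ∈ Finset.range n, (trigMon (i + 1) x + trigMon (-(i + 1)) x) := by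
  induction n with
  | zero => simp [dirichletKer, trigMon_zero]
  | succ n ih =>
    rw [Finset.sum_range_succ, ← add_assoc, ← ih, dirichletKer, dirichletKer]
    have h : Finset.Icc (-((n + 1 : ℕ) : ℤ)) ((n + 1 : ℕ) : ℤ)
        = insert ((n : ℤ) + 1) (insert (-((n : ℤ) + 1)) (Finset.Icc (-(n : ℤ)) (n : ℤ))) := by
      ext k; simp only [Finset.mem_Icc, Finset.mem_insert]; push_cast; omega
    rw [h, Finset.sum_insert, Finset.sum_insert]
    · ring
    · simp
    · simp only [Finset.mem_Icc, Finset.mem_insert]; omega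

/-- Positivity of the kernel makes its L¹ norm equal to its integral. In the induction, the new row
and column of the double sum ∑ e^{i(j-k)x} form the next Dirichlet kernel, the corner term being its
constant 1. -/
lemma fejerKer_eq (M : ℕ) (x : ℝ) :
    fejerKer M x = ((‖∑ j ∈ Finset.range M, trigMon j x‖ ^ 2 : ℝ) : ℂ) := by
  have hc : ∀ z : ℂ, ((‖z‖ ^ 2 : ℝ) : ℂ) = z * starRingEnd ℂ z := fun z => by
    rw [Complex.mul_conj, Complex.normSq_eq_norm_sq]
  rw [hc]
  induction M with
  | zero => simp [fejerKer]
  | succ M ih =>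
    have h1 : fejerKer (M + 1) x = fejerKer M x + dirichletKer M x := Finset.sum_range_succ _ _
    rw [h1, ih, Finset.sum_range_succ, map_add, ← trigMon_neg, dirichletKer_eq, map_sum]
    have h2 : ∑ i ∈ Finset.range M, (trigMon (i + 1) x + trigMon (-(i + 1)) x)
        = trigMon M x * (∑ i ∈ Finset.range M, starRingEnd ℂ (trigMon i x))
          + (∑ i ∈ Finset.range M, trigMon i x) * trigMon (-M) x := by
      rw [← Finset.sum_range_reflect, Finset.mul_sum, Finset.sum_mul, ← Finset.sum_add_distrib]
      refine Finset.sum_congr rfl fun i hi => ?_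
      have hi' := Finset.mem_range.1 hi
      rw [← trigMon_neg, ← trigMon_add, ← trigMon_add]
      congr 2 <;> omega
    have h3 : trigMon M x * trigMon (-M) x = 1 := by
      rw [← trigMon_add]; simp [trigMon_zero]
    rw [h2]
    linear_combination -h3

lemma integral_norm_fejerKer (M : ℕ) :
    ∫ x in (-Real.pi)..Real.pi, ‖fejerKer M x‖ = 2 * Real.pi * M := by
  have h1 : ∀ x, ((‖fejerKer M x‖ : ℝ) : ℂ) = fejerKer M x := fun x => by
    rw [fejerKer_eq, Complex.norm_real, Real.norm_eq_abs, abs_of_nonneg (by positivity)]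
  have h2 : ∫ x in (-Real.pi)..Real.pi, fejerKer M x = (2 * Real.pi * M : ℂ) := by
    unfold fejerKer
    rw [intervalIntegral.integral_finsetSum fun j _ =>
      (continuous_dirichletKer j).intervalIntegrable _ _]
    have h3 : ∀ j ∈ Finset.range M,
        ∫ x in (-Real.pi)..Real.pi, dirichletKer j x = 2 * Real.pi := by
      intro j _
      unfold dirichletKer
      rw [intervalIntegral.integral_finsetSum fun k _ =>
        (continuous_trigMon k).intervalIntegrable _ _]
      simp only [integral_trigMon]
      rw [Finset.sum_ite_eq', if_pos (by simp)]
    rw [Finset.sum_congr rfl h3]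
    simp; ring
  rw [← intervalIntegral.integral_congr (fun x _ => h1 x), intervalIntegral.integral_ofReal] at h2
  exact_mod_cast h2

lemma fourierPartialSum_eq_integral {f : ℝ → ℂ} (hf : L1Int f) (n : ℕ) (x : ℝ) :
    fourierPartialSum f n x
      = (1 / (2 * Real.pi) : ℂ) * ∫ t in (-Real.pi)..Real.pi, dirichletKer n (x - t) * f t := by
  rw [fourierPartialSum_eq]
  have h : ∀ t, dirichletKer n (x - t) * f t
      = ∑ k ∈ Finset.Icc (-(n : ℤ)) (n : ℤ), trigMon k x * (trigMon (-k) t * f t) := fun t => by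
    rw [dirichletKer, Finset.sum_mul]
    exact Finset.sum_congr rfl fun k _ => by rw [trigMon_sub_arg]; ring
  simp only [h]
  rw [intervalIntegral.integral_finsetSum fun k _ => (hf.trigMon_mul _).const_mul _,
    Finset.mul_sum]
  refine Finset.sum_congr rfl fun k _ => ?_
  rw [intervalIntegral.integral_const_mul, fcoeff_eq]; ring

lemma sum_fourierPartialSum_eq_integral {f : ℝ → ℂ} (hf : L1Int f) (M : ℕ) (x : ℝ) :
    ∑ j ∈ Finset.range M, fourierPartialSum f j x
      = (1 / (2 * Real.pi) : ℂ) * ∫ t in (-Real.pi)..Real.pi, fejerKer M (x - t) * f t := by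
  simp only [fejerKer, Finset.sum_mul]
  rw [intervalIntegral.integral_finsetSum, Finset.mul_sum]
  · exact Finset.sum_congr rfl fun j _ => fourierPartialSum_eq_integral hf j x
  · intro j _
    exact IntervalIntegrable.continuousOn_mul hf (Continuous.continuousOn (by fun_prop))

/-- Young's inequality for the convolution with a continuous periodic kernel. -/
lemma integral_norm_convolution_le {f K : ℝ → ℂ} (hf : L1Int f) (hK : Continuous K)
    (hp : Function.Periodic K (2 * Real.pi)) {B : ℝ} (hB : ∀ x, ‖K x‖ ≤ B) :
    ∫ x in (-Real.pi)..Real.pi, ‖∫ t in (-Real.pi)..Real.pi, K (x - t) * f t‖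
      ≤ (∫ x in (-Real.pi)..Real.pi, ‖K x‖) * normL f := by
  have hpi := Real.pi_pos
  have hle : -Real.pi ≤ Real.pi := by linarith
  set ν := MeasureTheory.volume.restrict (Set.Ioc (-Real.pi) Real.pi) with hν
  have hfI : MeasureTheory.Integrable f ν :=
    (intervalIntegrable_iff_integrableOn_Ioc_of_le hle).1 hf
  have hprod : MeasureTheory.Integrable (fun z : ℝ × ℝ => K (z.1 - z.2) * f z.2) (ν.prod ν) :=
    (hfI.comp_snd ν).bdd_mul (c := B)
      (Continuous.aestronglyMeasurable (by fun_prop)) (Filter.Eventually.of_forall fun z => hB _)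
  have hswap := MeasureTheory.integral_integral_swap (f := fun x t => ‖K (x - t) * f t‖) hprod.norm
  have hleft := hprod.integral_norm_prod_left
  simp only [normL, intervalIntegral.integral_of_le hle]
  calc ∫ x, ‖∫ t, K (x - t) * f t ∂ν‖ ∂ν ≤ ∫ x, ∫ t, ‖K (x - t) * f t‖ ∂ν ∂ν :=
        MeasureTheory.integral_mono_of_nonneg (Filter.Eventually.of_forall fun x => norm_nonneg _)
          hleft (Filter.Eventually.of_forall fun x => MeasureTheory.norm_integral_le_integral_norm _)
    _ = ∫ t, ∫ x, ‖K (x - t) * f t‖ ∂ν ∂ν := hswap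
    _ = ∫ t, (∫ x, ‖K x‖ ∂ν) * ‖f t‖ ∂ν := by
        congr 1; ext t
        simp only [norm_mul]
        rw [MeasureTheory.integral_mul_const]
        congr 1
        rw [hν, ← intervalIntegral.integral_of_le hle, ← intervalIntegral.integral_of_le hle,
          intervalIntegral.integral_comp_sub_right (fun x => ‖K x‖)]
        have hpn : Function.Periodic (fun x => ‖K x‖) (2 * Real.pi) := fun x => by simp only [hp x]
        have := hpn.intervalIntegral_add_eq (-Real.pi - t) (-Real.pi)
        rw [show Real.pi - t = -Real.pi - t + 2 * Real.pi by ring, this]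
        congr 1; ring
    _ = _ := MeasureTheory.integral_const_mul _ _

lemma norm_fejerKer_le (M : ℕ) (x : ℝ) : ‖fejerKer M x‖ ≤ (M : ℝ) ^ 2 := by
  rw [fejerKer_eq, Complex.norm_real, Real.norm_eq_abs, abs_of_nonneg (by positivity)]
  have : ‖∑ j ∈ Finset.range M, trigMon j x‖ ≤ M := by
    simpa using norm_sum_trigMon_le 0 M x
  gcongr

/-- Fejér means contract L¹, which lets approximation by polynomials prove Fejér's theorem. -/
lemma normL_sum_fourierPartialSum_le {f : ℝ → ℂ} (hf : L1Int f) (M : ℕ) :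
    normL (fun x => ∑ j ∈ Finset.range M, fourierPartialSum f j x) ≤ M * normL f := by
  have hpi := Real.pi_pos
  have hpi' : (Real.pi : ℂ) ≠ 0 := by exact_mod_cast Real.pi_ne_zero
  simp only [sum_fourierPartialSum_eq_integral hf]
  rw [normL_const_mul]
  have h := integral_norm_convolution_le hf (continuous_fejerKer M) (fejerKer_periodic M)
    (norm_fejerKer_le M)
  rw [integral_norm_fejerKer] at h
  have h1 : ‖(1 / (2 * Real.pi) : ℂ)‖ = 1 / (2 * Real.pi) := by
    rw [norm_div, norm_mul, Complex.norm_real, Real.norm_eq_abs, abs_of_pos hpi, Complex.norm_two,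
      norm_one]
  rw [h1]
  calc _ ≤ 1 / (2 * Real.pi) * (2 * Real.pi * M * normL f) :=
        mul_le_mul_of_nonneg_left h (by positivity)
    _ = _ := by field_simp

/-- Trigonometric polynomials are dense in `L¹(-π, π)`. -/
lemma exists_trigPoly_normL_sub_lt {f : ℝ → ℂ} (hf : L1Int f) {ε : ℝ} (hε : 0 < ε) :
    ∃ (s : Finset ℤ) (c : ℤ → ℂ), normL (fun x => f x - ∑ k ∈ s, c k * trigMon k x) < ε := by
  have hpi := Real.pi_pos
  have hle : -Real.pi ≤ Real.pi := by linarith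
  have : Fact (0 < 2 * Real.pi) := ⟨by positivity⟩
  have : Fact ((1 : ENNReal) ≤ 1) := ⟨le_rfl⟩
  have hend : -Real.pi + 2 * Real.pi = Real.pi := by ring
  have hmem : MeasureTheory.MemLp f 1
      (MeasureTheory.volume.restrict (Set.Ioc (-Real.pi) (-Real.pi + 2 * Real.pi))) := by
    rw [MeasureTheory.memLp_one_iff_integrable, hend]
    exact (intervalIntegrable_iff_integrableOn_Ioc_of_le hle).1 hf
  have hF := hmem.memLp_liftIoc.haarAddCircle
  set F := AddCircle.liftIoc (2 * Real.pi) (-Real.pi) f with hFdef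
  have hcl : hF.toLp F ∈ closure
      (Submodule.span ℂ (Set.range (@fourierLp (2 * Real.pi) _ 1 _)) : Set _) := by
    rw [← Submodule.topologicalClosure_coe, span_fourierLp_closure_eq_top ENNReal.one_ne_top]
    trivial
  obtain ⟨P, hP, hdist⟩ := Metric.mem_closure_iff.1 hcl (ε / (2 * Real.pi)) (by positivity)
  obtain ⟨c, rfl⟩ := (Finsupp.mem_span_range_iff_exists_finsupp).1 hP
  refine ⟨c.support, c, ?_⟩
  rw [dist_eq_norm, MeasureTheory.L1.norm_eq_integral_norm] at hdist
  have hsum : ∀ s : Finset ℤ, ((∑ k ∈ s, c k • fourierLp 1 k :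
      MeasureTheory.Lp ℂ 1 (@AddCircle.haarAddCircle (2 * Real.pi) _)) : AddCircle (2 * Real.pi) → ℂ)
      =ᵐ[AddCircle.haarAddCircle] fun y => ∑ k ∈ s, c k * fourier k y := by
    intro s
    induction s using Finset.induction_on with
    | empty =>
      simp only [Finset.sum_empty]
      exact MeasureTheory.Lp.coeFn_zero ℂ 1 _
    | insert k s hk ih =>
      rw [Finset.sum_insert hk]
      filter_upwards [MeasureTheory.Lp.coeFn_add (c k • fourierLp 1 k)
        (∑ k ∈ s, c k • fourierLp 1 k), ih,
        MeasureTheory.Lp.coeFn_smul (c k) (@fourierLp (2 * Real.pi) _ 1 _ k),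
        coeFn_fourierLp 1 k] with y h1 h2 h3 h4
      rw [h1, Pi.add_apply, h2, h3, Pi.smul_apply, h4, Finset.sum_insert hk, smul_eq_mul]
  have hae : (fun y => ‖(hF.toLp F - c.sum fun k a => a • fourierLp 1 k :
      MeasureTheory.Lp ℂ 1 _) y‖) =ᵐ[AddCircle.haarAddCircle]
      fun y => ‖F y - ∑ k ∈ c.support, c k * fourier k y‖ := by
    filter_upwards [MeasureTheory.Lp.coeFn_sub (hF.toLp F) (c.sum fun k a => a • fourierLp 1 k),
      hF.coeFn_toLp, hsum c.support] with y h1 h2 h3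
    rw [h1, Pi.sub_apply, h2]
    rw [← h3]; rfl
  rw [MeasureTheory.integral_congr_ae hae, AddCircle.integral_haarAddCircle,
    ← AddCircle.intervalIntegral_preimage (2 * Real.pi) (-Real.pi), hend, smul_eq_mul,
    inv_mul_lt_iff₀ (by positivity), mul_div_cancel₀ _ (by positivity)] at hdist
  refine lt_of_eq_of_lt ?_ hdist
  unfold normL
  rw [intervalIntegral.integral_of_le hle, intervalIntegral.integral_of_le hle]
  refine MeasureTheory.setIntegral_congr_fun measurableSet_Ioc fun x hx => ?_
  simp only
  rw [hFdef, AddCircle.liftIoc_coe_apply (by rwa [hend])]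
  congr 2
  refine Finset.sum_congr rfl fun k _ => ?_
  rw [fourier_coe_apply, trigMon]
  congr 2
  have : (Real.pi : ℂ) ≠ 0 := by exact_mod_cast Real.pi_ne_zero
  push_cast
  field_simp

lemma fourierPartialSum_sub {f g : ℝ → ℂ} (hf : L1Int f) (hg : L1Int g) (n : ℕ) (x : ℝ) :
    fourierPartialSum (fun x => f x - g x) n x
      = fourierPartialSum f n x - fourierPartialSum g n x := by
  simp only [fourierPartialSum_eq, fcoeff_sub hf hg, sub_mul, Finset.sum_sub_distrib]

lemma exists_fourierPartialSum_trigPoly_eq (s : Finset ℤ) (c : ℤ → ℂ) :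
    ∃ d : ℕ, ∀ n ≥ d, ∀ x, fourierPartialSum (fun x => ∑ k ∈ s, c k * trigMon k x) n x
      = ∑ k ∈ s, c k * trigMon k x := by
  refine ⟨s.sup Int.natAbs, fun n hn x => ?_⟩
  rw [fourierPartialSum_eq]
  simp only [fcoeff_sum_trigMon, ite_mul, zero_mul]
  rw [← Finset.sum_filter]
  refine Finset.sum_congr ?_ fun _ _ => rfl
  ext k
  simp only [Finset.mem_filter, Finset.mem_Icc, and_iff_right_iff_imp]
  intro hk
  have := Finset.le_sup (f := Int.natAbs) hk
  omega

/-- Fejér's theorem in `L¹`, for unnormalised means. -/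
lemma exists_normL_sub_sum_fourierPartialSum_le {f : ℝ → ℂ} (hf : L1Int f) {ε : ℝ} (hε : 0 < ε) :
    ∃ C : ℝ, ∀ M : ℕ,
      normL (fun x => M * f x - ∑ j ∈ Finset.range M, fourierPartialSum f j x) ≤ ε * M + C := by
  -- The error f - P enters twice, directly and through its Fejér sum, hence ε/2.
  obtain ⟨s, c, hsc⟩ := exists_trigPoly_normL_sub_lt hf (half_pos hε)
  obtain ⟨d, hd⟩ := exists_fourierPartialSum_trigPoly_eq s c
  set P : ℝ → ℂ := fun x => ∑ k ∈ s, c k * trigMon k x with hP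
  have hPc : Continuous P := by rw [hP]; fun_prop
  have hPi : L1Int P := hPc.l1Int
  have hd : ∀ n ≥ d, ∀ x, fourierPartialSum P n x = P x := hd
  have hhi : L1Int (fun x => f x - P x) := hf.sub hPi
  -- Only the finitely many j < d can have S_j P ≠ P, so their total cost does not depend on M.
  refine ⟨∑ j ∈ Finset.range d, normL (fun x => P x - fourierPartialSum P j x), fun M => ?_⟩
  have hid : ∀ x, M * f x - ∑ j ∈ Finset.range M, fourierPartialSum f j x
      = (M * (f x - P x) - ∑ j ∈ Finset.range M, fourierPartialSum (fun x => f x - P x) j x)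
        + ∑ j ∈ Finset.range M, (P x - fourierPartialSum P j x) := by
    intro x
    simp only [fourierPartialSum_sub hf hPi, Finset.sum_sub_distrib]
    simp; ring
  simp only [hid]
  have i1 : L1Int (fun x => (M : ℂ) * (f x - P x)) := hhi.const_mul _
  have i2 : L1Int (fun x => ∑ j ∈ Finset.range M, fourierPartialSum (fun x => f x - P x) j x) :=
    Continuous.l1Int (by fun_prop)
  have i3 : L1Int (fun x => ∑ j ∈ Finset.range M, (P x - fourierPartialSum P j x)) :=
    Continuous.l1Int (by fun_prop)
  refine (normL_add_le (i1.sub i2) i3).trans (add_le_add ?_ ?_)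
  · refine (normL_sub_le i1 i2).trans ?_
    rw [normL_const_mul]
    have := normL_sum_fourierPartialSum_le hhi M
    have h2 := mul_le_mul_of_nonneg_left hsc.le (Nat.cast_nonneg (α := ℝ) M)
    simp only [Complex.norm_natCast]
    linarith
  · refine (normL_sum_le _ fun j _ => Continuous.l1Int (by fun_prop)).trans ?_
    have hzero : ∀ j ∈ Finset.range M, j ∉ Finset.range M ∩ Finset.range d →
        normL (fun x => P x - fourierPartialSum P j x) = 0 := by
      intro j hj hjd
      rw [Finset.mem_inter, not_and, Finset.mem_range, Finset.mem_range, not_lt] at hjd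
      simp [normL, hd j (hjd (Finset.mem_range.1 hj))]
    rw [← Finset.sum_subset Finset.inter_subset_left hzero]
    exact Finset.sum_le_sum_of_subset_of_nonneg Finset.inter_subset_right
      fun j _ _ => normL_nonneg _

/-! ### L¹ estimates for blocks of partial sums. -/

/-- Abel's inequality against the common majorant. The case σ = -1 is the reflection x ↦ -x, under
which the majorant is even. -/
lemma normL_sum_mul_trigMon_le {σ : ℤ} (hσ : σ = 1 ∨ σ = -1) (b : ℕ → ℂ) (a : ℤ) {n N : ℕ}
    (hn : n ≤ N) (hN : 2 ≤ N) :
    normL (fun x => ∑ i ∈ Finset.range n, b i * trigMon (σ * (a + i)) x)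
      ≤ (‖b (n - 1)‖ + ∑ i ∈ Finset.range (n - 1), ‖b (i + 1) - b i‖)
        * (8 * (1 + Real.pi) * Real.log N) := by
  refine normL_le_of_le_kernelBound (Continuous.l1Int (by fun_prop)) (by positivity) hN
    fun x hx => ?_
  refine norm_sum_range_mul_le b (fun i => trigMon (σ * (a + i)) x) n fun m hm => ?_
  rcases hσ with rfl | rfl
  · simpa using norm_sum_trigMon_le_kernelBound a (hm.trans hn) hx
  · have h := norm_sum_trigMon_le_kernelBound a (hm.trans hn) (x := -x) (by rwa [abs_neg])
    have e : ∀ k : ℤ, trigMon (-1 * k) x = trigMon k (-x) := fun k => by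
      simp [trigMon]
    simpa only [e, kernelBound, abs_neg] using h

lemma fourierPartialSum_add_sub (f : ℝ → ℂ) (n m : ℕ) (x : ℝ) :
    fourierPartialSum f (n + m) x - fourierPartialSum f n x
      = ∑ i ∈ Finset.range m, fcoeff f (1 * ((n + 1 : ℤ) + i)) * trigMon (1 * ((n + 1 : ℤ) + i)) x
      + ∑ i ∈ Finset.range m,
          fcoeff f (-1 * ((n + 1 : ℤ) + i)) * trigMon (-1 * ((n + 1 : ℤ) + i)) x := by
  induction m with
  | zero => simp
  | succ m ih =>
    have h : Finset.Icc (-((n + (m + 1) : ℕ) : ℤ)) ((n + (m + 1) : ℕ) : ℤ)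
        = insert (1 * ((n + 1 : ℤ) + m)) (insert (-1 * ((n + 1 : ℤ) + m))
          (Finset.Icc (-((n + m : ℕ) : ℤ)) ((n + m : ℕ) : ℤ))) := by
      ext k; simp only [Finset.mem_Icc, Finset.mem_insert]; push_cast; omega
    have h2 : fourierPartialSum f (n + (m + 1)) x
        = fcoeff f (1 * ((n + 1 : ℤ) + m)) * trigMon (1 * ((n + 1 : ℤ) + m)) x
        + (fcoeff f (-1 * ((n + 1 : ℤ) + m)) * trigMon (-1 * ((n + 1 : ℤ) + m)) x
        + fourierPartialSum f (n + m) x) := by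
      rw [fourierPartialSum_eq, h, Finset.sum_insert, Finset.sum_insert, fourierPartialSum_eq]
      · simp only [Finset.mem_Icc]; push_cast; omega
      · simp only [Finset.mem_Icc, Finset.mem_insert]; push_cast; omega
    rw [Finset.sum_range_succ, Finset.sum_range_succ, h2]
    linear_combination ih

/-- The coefficients `f̂(σk)`, `k ≥ 0`, for a sign `σ`. -/
noncomputable def sideCoeff (f : ℝ → ℂ) (σ : ℤ) (k : ℕ) : ℂ := fcoeff f (σ * k)

lemma deltaPos_eq (f : ℝ → ℂ) (k : ℕ) : deltaPos f k = sideCoeff f 1 (k + 1) - sideCoeff f 1 k := by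
  simp [deltaPos, sideCoeff]

lemma deltaNeg_eq (f : ℝ → ℂ) (k : ℕ) :
    deltaNeg f k = sideCoeff f (-1) (k + 1) - sideCoeff f (-1) k := by
  unfold deltaNeg sideCoeff
  congr 2 <;> push_cast <;> ring

lemma normL_sideBlock_le (f : ℝ → ℂ) {σ : ℤ} (hσ : σ = 1 ∨ σ = -1) {n m : ℕ} (hm : 0 < m)
    (hN : 2 ≤ n + m) :
    normL (fun x => ∑ i ∈ Finset.range m,
        fcoeff f (σ * ((n + 1 : ℤ) + i)) * trigMon (σ * ((n + 1 : ℤ) + i)) x)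
      ≤ (‖sideCoeff f σ (n + m)‖
          + ∑ k ∈ Finset.Ico (n + 1) (n + m), ‖sideCoeff f σ (k + 1) - sideCoeff f σ k‖)
        * (8 * (1 + Real.pi) * Real.log (n + m : ℕ)) := by
  have h := normL_sum_mul_trigMon_le hσ (fun i => sideCoeff f σ (n + 1 + i)) (n + 1 : ℤ)
    (n := m) (N := n + m) (by omega) hN
  rw [Finset.sum_Ico_eq_sum_range]
  convert h using 3
  · simp [sideCoeff]
  · congr 2; omega
  · rw [show n + m - (n + 1) = m - 1 by omega]; rfl

lemma normL_fourierPartialSum_add_sub_le (f : ℝ → ℂ) {n m : ℕ} (hm : 0 < m) (hN : 2 ≤ n + m) :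
    normL (fun x => fourierPartialSum f (n + m) x - fourierPartialSum f n x)
      ≤ (‖sideCoeff f 1 (n + m)‖ + ‖sideCoeff f (-1) (n + m)‖
          + ∑ k ∈ Finset.Ico (n + 1) (n + m), (‖deltaPos f k‖ + ‖deltaNeg f k‖))
        * (8 * (1 + Real.pi) * Real.log (n + m : ℕ)) := by
  simp only [fourierPartialSum_add_sub]
  refine (normL_add_le (Continuous.l1Int (by fun_prop)) (Continuous.l1Int (by fun_prop))).trans ?_
  refine (add_le_add (normL_sideBlock_le f (Or.inl rfl) hm hN)
    (normL_sideBlock_le f (Or.inr rfl) hm hN)).trans (le_of_eq ?_)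
  simp only [deltaPos_eq, deltaNeg_eq, Finset.sum_add_distrib]
  ring

/-! ### Convergence from coefficient decay. -/

/-- The two-sided variation condition `lim_{μ → 1} limsup_n ∑_{n ≤ k ≤ μn} … log k = 0`,
written out. -/
def SmallLogVariation (v : ℕ → ℝ) : Prop :=
  ∀ η > 0, ∃ μ : ℝ, 1 < μ ∧ μ ≤ 2 ∧ ∀ᶠ n : ℕ in atTop,
    ∑ k ∈ Finset.Icc n ⌊μ * (n : ℝ)⌋₊, v k * Real.log k ≤ η

lemma log_le_two_mul_log {a b : ℝ} (ha : 0 < a) (h : a ≤ b ^ 2) :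
    Real.log a ≤ 2 * Real.log b := by
  have := Real.log_le_log ha h
  rwa [Real.log_pow, Nat.cast_ofNat] at this

lemma sum_Ico_mul_log_le {v : ℕ → ℝ} (hv : ∀ k, 0 ≤ v k) {n a b N : ℕ} (hn : 1 ≤ n) (ha : n ≤ a)
    (hb : b ≤ N + 1) :
    (∑ k ∈ Finset.Ico a b, v k) * Real.log n ≤ ∑ k ∈ Finset.Icc n N, v k * Real.log k := by
  rw [Finset.sum_mul]
  have hn' : (1 : ℝ) ≤ n := by exact_mod_cast hn
  calc ∑ k ∈ Finset.Ico a b, v k * Real.log n ≤ ∑ k ∈ Finset.Ico a b, v k * Real.log k := by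
        refine Finset.sum_le_sum fun k hk => mul_le_mul_of_nonneg_left ?_ (hv k)
        refine Real.log_le_log (by linarith) ?_
        exact_mod_cast ha.trans (Finset.mem_Ico.1 hk).1
    _ ≤ _ := by
        refine Finset.sum_le_sum_of_subset_of_nonneg (fun k hk => ?_)
          fun k _ _ => mul_nonneg (hv k) (Real.log_natCast_nonneg k)
        rw [Finset.mem_Ico] at hk
        rw [Finset.mem_Icc]; omega

/-- De la Vallée Poussin averaging over n ≤ j < N = ⌊μn⌋: the number of terms is comparable to n, so
the o(n) error of unnormalised Fejér sums is negligible. -/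
lemma tendsto_normL_sub_fourierPartialSum {f : ℝ → ℂ} (hf : L1Int f)
    (hpos : Tendsto (fun k : ℕ => ‖sideCoeff f 1 k‖ * Real.log k) atTop (𝓝 0))
    (hneg : Tendsto (fun k : ℕ => ‖sideCoeff f (-1) k‖ * Real.log k) atTop (𝓝 0))
    (hvar : SmallLogVariation fun k => ‖deltaPos f k‖ + ‖deltaNeg f k‖) :
    Tendsto (fun n : ℕ => normL (fun x => f x - fourierPartialSum f n x)) atTop (𝓝 0) := by
  have hpi := Real.pi_pos
  rw [Metric.tendsto_atTop']
  intro ε hε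
  set K : ℝ := 8 * (1 + Real.pi) with hK
  have hKpos : 0 < K := by positivity
  -- Two end coefficients cost η each and the variation 2η, so a block costs at most 4Kη = ε/4.
  set η : ℝ := ε / (16 * K) with hη
  have hηpos : 0 < η := by positivity
  obtain ⟨μ, hμ1, hμ2, hμ⟩ := hvar η hηpos
  -- As N ≤ 2n, the two Fejér errors total at most (μ-1)εn/16 + 2C, and 2C < (μ-1)εn/8 for large n;
  -- together this is below (μ-1)εn/4 < (N-n)ε/2.
  obtain ⟨C, hC⟩ := exists_normL_sub_sum_fourierPartialSum_le hf
    (ε := (μ - 1) * ε / 48) (by have : 0 < μ - 1 := by linarith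
                                positivity)
  have hC0 : 0 ≤ C := by simpa using (normL_nonneg _).trans (hC 0)
  obtain ⟨n₁, hn₁⟩ := eventually_atTop.1 hμ
  obtain ⟨n₂, hn₂⟩ := eventually_atTop.1 (hpos.eventually (gt_mem_nhds hηpos))
  obtain ⟨n₃, hn₃⟩ := eventually_atTop.1 (hneg.eventually (gt_mem_nhds hηpos))
  -- Ensures that rounding costs at most half the gap: N - n > (μ-1)n - 1 > (μ-1)n/2.
  obtain ⟨n₄, hn₄⟩ := exists_nat_gt (2 / (μ - 1))
  obtain ⟨n₅, hn₅⟩ := exists_nat_gt (16 * C / ((μ - 1) * ε))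
  refine ⟨n₁ + n₂ + n₃ + n₄ + n₅ + 2, fun n hn => ?_⟩
  rw [Real.dist_eq, sub_zero, abs_of_nonneg (normL_nonneg _)]
  have hμ0 : 0 < μ - 1 := by linarith
  have hn4 : 2 < (μ - 1) * n := by
    rw [div_lt_iff₀ hμ0] at hn₄
    have : (n₄ : ℝ) ≤ n := by exact_mod_cast (by omega : n₄ ≤ n)
    nlinarith
  have hn5 : 16 * C < (μ - 1) * ε * n := by
    rw [div_lt_iff₀ (by positivity)] at hn₅
    have h1 : (n₅ : ℝ) ≤ n := by exact_mod_cast (by omega : n₅ ≤ n)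
    have h2 : 0 < (μ - 1) * ε := by positivity
    nlinarith
  have hn2 : (2 : ℝ) ≤ n := by exact_mod_cast (by omega : 2 ≤ n)
  set N : ℕ := ⌊μ * (n : ℝ)⌋₊ with hN
  have hNle : (N : ℝ) ≤ μ * n := Nat.floor_le (by positivity)
  have hNlt : μ * n < N + 1 := Nat.lt_floor_add_one _
  have hnN : n ≤ N := by
    have : (n : ℝ) < N := by nlinarith
    exact_mod_cast this.le
  have hN2n : N ≤ 2 * n := by
    have : (N : ℝ) ≤ 2 * n := by nlinarith
    exact_mod_cast this
  have hblock : ∀ j ∈ Finset.Ico n N,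
      normL (fun x => fourierPartialSum f j x - fourierPartialSum f n x) ≤ ε / 2 := by
    intro j hj
    rw [Finset.mem_Ico] at hj
    obtain ⟨m, rfl⟩ := Nat.exists_eq_add_of_le hj.1
    rcases Nat.eq_zero_or_pos m with rfl | hm
    · simp only [normL, add_zero, sub_self, norm_zero, intervalIntegral.integral_zero]
      positivity
    refine (normL_fourierPartialSum_add_sub_le f hm (by omega)).trans ?_
    have a1 := (hn₂ (n + m) (by omega)).le
    have a2 := (hn₃ (n + m) (by omega)).le
    have a3 := (sum_Ico_mul_log_le (v := fun k => ‖deltaPos f k‖ + ‖deltaNeg f k‖)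
      (fun k => by positivity) (n := n) (a := n + 1) (b := n + m) (N := N) (by omega) (by omega)
      (by omega)).trans (hn₁ n (by omega))
    have a4 : Real.log (n + m : ℕ) ≤ 2 * Real.log n := by
      refine log_le_two_mul_log (by exact_mod_cast (by omega : 0 < n + m)) ?_
      have : ((n + m : ℕ) : ℝ) ≤ 2 * n := by exact_mod_cast (by omega : n + m ≤ 2 * n)
      nlinarith
    set V := ∑ k ∈ Finset.Ico (n + 1) (n + m), (‖deltaPos f k‖ + ‖deltaNeg f k‖) with hV
    have hV0 : 0 ≤ V := Finset.sum_nonneg fun k _ => by positivity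
    have a5 : V * Real.log (n + m : ℕ) ≤ 2 * η := by nlinarith
    have a6 : (‖sideCoeff f 1 (n + m)‖ + ‖sideCoeff f (-1) (n + m)‖ + V)
        * (8 * (1 + Real.pi) * Real.log (n + m : ℕ)) ≤ K * (4 * η) := by
      rw [← hK]; nlinarith
    refine a6.trans ?_
    rw [hη]
    have : K * (4 * (ε / (16 * K))) = ε / 4 := by field_simp; norm_num
    rw [this]; linarith
  have hcast : ((N - n : ℕ) : ℝ) = N - n := by rw [Nat.cast_sub hnN]
  have hgap : (μ - 1) * n / 2 < N - n := by linarith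
  have hmain : ((N - n : ℕ) : ℝ) * normL (fun x => f x - fourierPartialSum f n x)
      ≤ ((μ - 1) * ε / 48 * N + C) + ((μ - 1) * ε / 48 * n + C) + (N - n : ℕ) * (ε / 2) := by
    rw [← Complex.norm_natCast, ← normL_const_mul, Complex.norm_natCast]
    have hid : ∀ x, ((N - n : ℕ) : ℂ) * (f x - fourierPartialSum f n x)
        = ((N * f x - ∑ j ∈ Finset.range N, fourierPartialSum f j x)
          - (n * f x - ∑ j ∈ Finset.range n, fourierPartialSum f j x))
          + ∑ j ∈ Finset.Ico n N, (fourierPartialSum f j x - fourierPartialSum f n x) := by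
      intro x
      rw [Finset.sum_sub_distrib, Finset.sum_Ico_eq_sub _ hnN, Nat.cast_sub hnN]
      simp [Nat.cast_sub hnN]; ring
    simp only [hid]
    have i1 : ∀ M : ℕ, L1Int (fun x => M * f x - ∑ j ∈ Finset.range M, fourierPartialSum f j x) :=
      fun M => (hf.const_mul _).sub (Continuous.l1Int (by fun_prop))
    refine (normL_add_le ((i1 N).sub (i1 n)) (Continuous.l1Int (by fun_prop))).trans
      (add_le_add ((normL_sub_le (i1 N) (i1 n)).trans (add_le_add (hC N) (hC n))) ?_)
    refine (normL_sum_le _ fun j _ => Continuous.l1Int (by fun_prop)).trans ?_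
    refine (Finset.sum_le_card_nsmul _ _ _ hblock).trans (le_of_eq ?_)
    simp
  have hN2n' : (N : ℝ) ≤ 2 * n := by exact_mod_cast hN2n
  have hμε : 0 < (μ - 1) * ε := by positivity
  have hfin : ((N - n : ℕ) : ℝ) * normL (fun x => f x - fourierPartialSum f n x)
      < (N - n : ℕ) * ε := by
    refine hmain.trans_lt ?_
    rw [hcast]
    nlinarith
  have hpos' : (0 : ℝ) < ((N - n : ℕ) : ℝ) := by rw [hcast]; nlinarith
  exact lt_of_mul_lt_mul_left hfin hpos'.le

/-! ### Mean value bounded variation and logarithmic averages. -/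

/-- The bounded variation condition of `MVBVS`, without the sector condition. -/
def MeanValueBoundedVariation (c : ℕ → ℂ) (lam C : ℝ) : Prop :=
  ∀ m : ℕ, 1 ≤ m → ∑ k ∈ Finset.Icc m (2 * m), ‖c (k + 1) - c k‖ ≤
    C * (1 / (m : ℝ)) * ∑ k ∈ Finset.Icc ⌊lam⁻¹ * (m : ℝ)⌋₊ ⌊lam * (m : ℝ)⌋₊, ‖c k‖

/-- The averages appearing in `MeanValueBoundedVariation`, weighted by `log m`. -/
noncomputable def logAverage (c : ℕ → ℂ) (lam : ℝ) (m : ℕ) : ℝ :=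
  Real.log m / m * ∑ k ∈ Finset.Icc ⌊lam⁻¹ * (m : ℝ)⌋₊ ⌊lam * (m : ℝ)⌋₊, ‖c k‖

lemma MeanValueBoundedVariation.tendsto_log_mul_variation {c : ℕ → ℂ} {lam C : ℝ}
    (h : MeanValueBoundedVariation c lam C) (ha : Tendsto (logAverage c lam) atTop (𝓝 0)) :
    Tendsto (fun m : ℕ => Real.log m * ∑ k ∈ Finset.Icc m (2 * m), ‖c (k + 1) - c k‖)
      atTop (𝓝 0) := by
  have h1 : Tendsto (fun m => C * logAverage c lam m) atTop (𝓝 0) := by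
    simpa using ha.const_mul C
  refine squeeze_zero' (Eventually.of_forall fun m => ?_) ?_ h1
  · exact mul_nonneg (Real.log_natCast_nonneg m) (Finset.sum_nonneg fun k _ => norm_nonneg _)
  · filter_upwards [eventually_ge_atTop 1] with m hm
    refine (mul_le_mul_of_nonneg_left (h m hm) (Real.log_natCast_nonneg m)).trans (le_of_eq ?_)
    rw [logAverage]; ring

/-- Every k in the window satisfies m ≤ k² for large m, so log m ≤ 2 log k, and the window has O(m)
terms. -/
lemma tendsto_logAverage_of_tendsto {c : ℕ → ℂ} {lam : ℝ} (hlam : 2 ≤ lam)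
    (hc : Tendsto (fun k : ℕ => ‖c k‖ * Real.log k) atTop (𝓝 0)) :
    Tendsto (logAverage c lam) atTop (𝓝 0) := by
  rw [Metric.tendsto_atTop']
  intro ε hε
  set η : ℝ := ε / (8 * lam) with hη
  have hηpos : 0 < η := by positivity
  obtain ⟨n₁, hn₁⟩ := eventually_atTop.1 (hc.eventually (gt_mem_nhds hηpos))
  obtain ⟨n₂, hn₂⟩ := exists_nat_gt (lam * (n₁ + 4 * lam ^ 2 + 4))
  refine ⟨n₂, fun m hm => ?_⟩
  have hm2 : lam * (n₁ + 4 * lam ^ 2 + 4) < m :=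
    hn₂.trans (by exact_mod_cast hm)
  have hlam0 : 0 < lam := by linarith
  have hmpos : (0 : ℝ) < m := lt_trans (by positivity) hm2
  have hnn : 0 ≤ logAverage c lam m := mul_nonneg
    (div_nonneg (Real.log_natCast_nonneg m) hmpos.le) (Finset.sum_nonneg fun k _ => norm_nonneg _)
  rw [Real.dist_eq, sub_zero, abs_of_nonneg hnn]
  have hq : n₁ + 4 * lam ^ 2 + 4 < lam⁻¹ * m := by
    rw [inv_mul_eq_div, lt_div_iff₀ hlam0]; linarith
  have hk : ∀ k ∈ Finset.Icc ⌊lam⁻¹ * (m : ℝ)⌋₊ ⌊lam * (m : ℝ)⌋₊,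
      Real.log m * ‖c k‖ ≤ 2 * η := by
    intro k hk
    have hk1 : lam⁻¹ * m < k + 1 := (Nat.lt_floor_add_one _).trans_le
      (by exact_mod_cast Nat.succ_le_succ (Finset.mem_Icc.1 hk).1)
    have hk2 : n₁ ≤ k := by
      have : (n₁ : ℝ) ≤ k := by nlinarith
      exact_mod_cast this
    have hk3 : (m : ℝ) ≤ (k : ℝ) ^ 2 := by
      rw [inv_mul_eq_div, div_lt_iff₀ hlam0] at hk1
      have : lam + 1 ≤ k := by nlinarith
      nlinarith
    have := log_le_two_mul_log hmpos hk3
    nlinarith [(hn₁ k hk2).le, norm_nonneg (c k)]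
  have hcard : (((Finset.Icc ⌊lam⁻¹ * (m : ℝ)⌋₊ ⌊lam * (m : ℝ)⌋₊).card : ℕ) : ℝ) ≤ lam * m + 1 := by
    rw [Nat.card_Icc]
    have h1 : ((⌊lam * (m : ℝ)⌋₊ + 1 - ⌊lam⁻¹ * (m : ℝ)⌋₊ : ℕ) : ℝ) ≤ (⌊lam * (m : ℝ)⌋₊ + 1 : ℕ) := by
      exact_mod_cast Nat.sub_le _ _
    refine h1.trans ?_
    push_cast
    linarith [Nat.floor_le (show 0 ≤ lam * (m : ℝ) by positivity)]
  have hsum := Finset.sum_le_card_nsmul _ _ _ hk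
  rw [← Finset.mul_sum, nsmul_eq_mul] at hsum
  rw [logAverage, div_mul_eq_mul_div, div_lt_iff₀ hmpos]
  refine hsum.trans_lt ?_
  have hm1 : 1 ≤ (m : ℝ) := by nlinarith
  calc _ ≤ (lam * m + 1) * (2 * η) := by gcongr
    _ ≤ (2 * (lam * m)) * (2 * η) := by gcongr; nlinarith
    _ = ε * m / 2 := by rw [hη]; field_simp; norm_num
    _ < ε * m := by nlinarith

/-! ### From Hilbert sums to coefficient decay. -/

/-- The sums `∑_{i=1}^{n} |c_{n+i}| / i`. -/
noncomputable def hilbertSum (c : ℕ → ℂ) (n : ℕ) : ℝ :=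
  ∑ i ∈ Finset.range n, ‖c (n + 1 + i)‖ / (i + 1)

lemma log_le_sum_inv (M : ℕ) : Real.log (M + 1) ≤ ∑ i ∈ Finset.range M, 1 / ((i : ℝ) + 1) := by
  have h := log_add_one_le_harmonic M
  rw [harmonic] at h
  push_cast at h
  simpa [one_div] using h

/-- Double counting: for each i < M the shift of [M, LM) by 1 + i still covers [2M, LM], so every
|c_j| there collects all the weights 1/(i+1), whose sum is at least log(M+1). -/
lemma sum_norm_mul_log_le_sum_hilbertSum (c : ℕ → ℂ) (L M : ℕ) :
    (∑ j ∈ Finset.Icc (2 * M) (L * M), ‖c j‖) * Real.log (M + 1)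
      ≤ ∑ n ∈ Finset.Ico M (L * M), hilbertSum c n := by
  calc _ ≤ (∑ j ∈ Finset.Icc (2 * M) (L * M), ‖c j‖) * ∑ i ∈ Finset.range M, 1 / ((i : ℝ) + 1) :=
        mul_le_mul_of_nonneg_left (log_le_sum_inv M) (Finset.sum_nonneg fun _ _ => norm_nonneg _)
    _ = ∑ i ∈ Finset.range M, (∑ j ∈ Finset.Icc (2 * M) (L * M), ‖c j‖) / ((i : ℝ) + 1) := by
        rw [Finset.mul_sum]; exact Finset.sum_congr rfl fun i _ => by ring
    _ ≤ ∑ i ∈ Finset.range M, ∑ n ∈ Finset.Ico M (L * M), ‖c (n + 1 + i)‖ / ((i : ℝ) + 1) := by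
        refine Finset.sum_le_sum fun i hi => ?_
        rw [← Finset.sum_div]
        refine div_le_div_of_nonneg_right ?_ (by positivity)
        have h1 := Finset.sum_Ico_add' (fun j => ‖c j‖) M (L * M) (1 + i)
        simp only [← add_assoc] at h1
        rw [h1]
        refine Finset.sum_le_sum_of_subset_of_nonneg (fun j hj => ?_) fun _ _ _ => norm_nonneg _
        rw [Finset.mem_Icc] at hj
        have := Finset.mem_range.1 hi
        rw [Finset.mem_Ico]; omega
    _ = ∑ n ∈ Finset.Ico M (L * M), ∑ i ∈ Finset.range M, ‖c (n + 1 + i)‖ / ((i : ℝ) + 1) :=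
        Finset.sum_comm
    _ ≤ _ := by
        refine Finset.sum_le_sum fun n hn => ?_
        refine Finset.sum_le_sum_of_subset_of_nonneg (fun i hi => ?_) fun _ _ _ => by positivity
        rw [Finset.mem_Ico] at hn
        rw [Finset.mem_range] at hi ⊢; omega

lemma tendsto_logAverage_of_hilbertSum {c : ℕ → ℂ} {lam : ℝ} (hlam : 2 ≤ lam)
    (hT : Tendsto (hilbertSum c) atTop (𝓝 0)) : Tendsto (logAverage c lam) atTop (𝓝 0) := by
  rw [Metric.tendsto_atTop']
  intro ε hε
  have hlam0 : 0 < lam := by linarith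
  -- With M about m/(2λ), one has m ≤ 4λM, hence λm ≤ 4λ²M ≤ LM, and [2M, LM] covers the window.
  obtain ⟨L, hL⟩ := exists_nat_gt (4 * lam ^ 2)
  have hLpos : (0 : ℝ) < L := lt_trans (by positivity) hL
  set η : ℝ := ε / (4 * L) with hη
  have hηpos : 0 < η := by positivity
  obtain ⟨n₁, hn₁⟩ := eventually_atTop.1 (hT.eventually (gt_mem_nhds hηpos))
  obtain ⟨n₂, hn₂⟩ := exists_nat_gt (4 * lam * (n₁ + lam + 4))
  refine ⟨n₂, fun m hm => ?_⟩
  have hm2 : 4 * lam * (n₁ + lam + 4) < m := hn₂.trans (by exact_mod_cast hm)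
  have hmpos : (0 : ℝ) < m := lt_trans (by positivity) hm2
  have hnn : 0 ≤ logAverage c lam m := mul_nonneg
    (div_nonneg (Real.log_natCast_nonneg m) hmpos.le) (Finset.sum_nonneg fun k _ => norm_nonneg _)
  rw [Real.dist_eq, sub_zero, abs_of_nonneg hnn]
  have hq : lam * (lam⁻¹ * m) = m := by field_simp
  set Q : ℕ := ⌊lam⁻¹ * (m : ℝ)⌋₊ with hQ
  have hQ1 : lam⁻¹ * m < Q + 1 := Nat.lt_floor_add_one _
  have hQ2 : (Q : ℝ) ≤ lam⁻¹ * m := Nat.floor_le (by positivity)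
  set M : ℕ := Q / 2 with hM
  have hM1 : (Q : ℝ) ≤ 2 * M + 1 := by exact_mod_cast (by omega : Q ≤ 2 * M + 1)
  have hM2 : (2 * M : ℝ) ≤ Q := by exact_mod_cast (by omega : 2 * M ≤ Q)
  have hmM : (m : ℝ) ≤ 2 * lam * (M + 1) := by nlinarith
  have hMbig : n₁ + lam + 4 ≤ (M : ℝ) := by
    by_contra hcon
    push Not at hcon
    have : (m : ℝ) < 2 * lam * (n₁ + lam + 4 + 1) := by nlinarith
    have h0 : (0 : ℝ) ≤ n₁ := Nat.cast_nonneg _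
    nlinarith
  have hn1M : n₁ ≤ M := by
    have : (n₁ : ℝ) ≤ M := by linarith
    exact_mod_cast this
  have hlog : Real.log m ≤ 2 * Real.log (M + 1) := log_le_two_mul_log hmpos (by nlinarith)
  have hMm : (M : ℝ) ≤ m := by
    have : lam⁻¹ * m ≤ m := by nlinarith
    nlinarith [Nat.cast_nonneg (α := ℝ) M]
  have hLM : ⌊lam * (m : ℝ)⌋₊ ≤ L * M := by
    refine Nat.floor_le_of_le ?_
    push_cast
    have h4 : (M : ℝ) + 1 ≤ 2 * M := by nlinarith [Nat.cast_nonneg (α := ℝ) n₁]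
    have : lam * m ≤ lam * (2 * lam * (2 * M)) := by
      refine mul_le_mul_of_nonneg_left (hmM.trans ?_) hlam0.le
      exact mul_le_mul_of_nonneg_left h4 (by positivity)
    nlinarith
  have hsub : ∑ k ∈ Finset.Icc Q ⌊lam * (m : ℝ)⌋₊, ‖c k‖
      ≤ ∑ j ∈ Finset.Icc (2 * M) (L * M), ‖c j‖ := by
    refine Finset.sum_le_sum_of_subset_of_nonneg ?_ fun _ _ _ => norm_nonneg _
    exact Finset.Icc_subset_Icc (by omega) hLM
  have hT' : ∑ n ∈ Finset.Ico M (L * M), hilbertSum c n ≤ L * M * η := by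
    refine (Finset.sum_le_card_nsmul _ _ η fun n hn => ?_).trans ?_
    · exact (hn₁ n (hn1M.trans (Finset.mem_Ico.1 hn).1)).le
    · rw [nsmul_eq_mul, Nat.card_Ico]
      refine mul_le_mul_of_nonneg_right ?_ hηpos.le
      exact_mod_cast Nat.sub_le _ _
  have hkey := (sum_norm_mul_log_le_sum_hilbertSum c L M).trans hT'
  rw [logAverage, div_mul_eq_mul_div, div_lt_iff₀ hmpos]
  set S := ∑ j ∈ Finset.Icc (2 * M) (L * M), ‖c j‖ with hS
  have hS0 : 0 ≤ S := Finset.sum_nonneg fun _ _ => norm_nonneg _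
  calc _ ≤ Real.log m * S := mul_le_mul_of_nonneg_left hsub (Real.log_natCast_nonneg m)
    _ ≤ 2 * Real.log (M + 1) * S := by gcongr
    _ ≤ 2 * (L * M * η) := by linarith
    _ ≤ 2 * (L * m * η) := by gcongr
    _ = ε * m / 2 := by rw [hη]; field_simp; norm_num
    _ < ε * m := by nlinarith

lemma norm_sub_le_sum_norm_sub (c : ℕ → ℂ) {m j N : ℕ} (hmj : m ≤ j) (hj : j ≤ N + 1) :
    ‖c j - c m‖ ≤ ∑ k ∈ Finset.Icc m N, ‖c (k + 1) - c k‖ := by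
  rw [← Finset.sum_Ico_sub c hmj]
  refine (norm_sum_le _ _).trans
    (Finset.sum_le_sum_of_subset_of_nonneg (fun k hk => ?_) fun _ _ _ => norm_nonneg _)
  rw [Finset.mem_Ico] at hk
  rw [Finset.mem_Icc]; omega

/-- Compare c_m with c_j up to the variation and average over j in [m, 2m), which lies in the window
because λ ≥ 2. -/
lemma tendsto_norm_mul_log_of_logAverage {c : ℕ → ℂ} {lam C : ℝ} (hlam : 2 ≤ lam)
    (h : MeanValueBoundedVariation c lam C) (ha : Tendsto (logAverage c lam) atTop (𝓝 0)) :
    Tendsto (fun k : ℕ => ‖c k‖ * Real.log k) atTop (𝓝 0) := by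
  have h1 := ha.add (h.tendsto_log_mul_variation ha)
  rw [add_zero] at h1
  refine squeeze_zero' (Eventually.of_forall fun m => ?_) ?_ h1
  · exact mul_nonneg (norm_nonneg _) (Real.log_natCast_nonneg m)
  filter_upwards [eventually_ge_atTop 1] with m hm
  have hmpos : (0 : ℝ) < m := by exact_mod_cast hm
  set V := ∑ k ∈ Finset.Icc m (2 * m), ‖c (k + 1) - c k‖ with hV
  have hterm : ∀ j ∈ Finset.Ico m (2 * m), ‖c m‖ ≤ ‖c j‖ + V := by
    intro j hj
    rw [Finset.mem_Ico] at hj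
    have := norm_sub_le_sum_norm_sub c hj.1 (by omega : j ≤ 2 * m + 1)
    have h2 := norm_sub_norm_le (c m) (c j)
    rw [norm_sub_rev] at h2
    linarith
  have hsum := Finset.sum_le_sum hterm
  rw [Finset.sum_const, Finset.sum_add_distrib, Finset.sum_const, Nat.card_Ico,
    show 2 * m - m = m by omega, nsmul_eq_mul, nsmul_eq_mul] at hsum
  have hsub : ∑ j ∈ Finset.Ico m (2 * m), ‖c j‖
      ≤ ∑ k ∈ Finset.Icc ⌊lam⁻¹ * (m : ℝ)⌋₊ ⌊lam * (m : ℝ)⌋₊, ‖c k‖ := by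
    refine Finset.sum_le_sum_of_subset_of_nonneg (fun k hk => ?_) fun _ _ _ => norm_nonneg _
    rw [Finset.mem_Ico] at hk
    rw [Finset.mem_Icc]
    constructor
    · refine (Nat.floor_le_of_le ?_).trans hk.1
      rw [inv_mul_eq_div, div_le_iff₀ (by linarith)]
      nlinarith
    · refine hk.2.le.trans (Nat.le_floor ?_)
      push_cast
      nlinarith
  have hl := Real.log_natCast_nonneg m
  rw [logAverage]
  have h3 : ‖c m‖ ≤ (∑ k ∈ Finset.Icc ⌊lam⁻¹ * (m : ℝ)⌋₊ ⌊lam * (m : ℝ)⌋₊, ‖c k‖) / m + V := by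
    rw [← sub_le_iff_le_add, le_div_iff₀ hmpos]
    linarith
  calc ‖c m‖ * Real.log m ≤ _ * Real.log m := mul_le_mul_of_nonneg_right h3 hl
    _ = _ := by ring

/-! ### Consequences of convergence on each side of the spectrum. -/

lemma sectorK_cos_mul_norm_le {θ : ℝ} (hθ : θ ≤ Real.pi) {z : ℂ} (hz : z ∈ sectorK θ) :
    Real.cos θ * ‖z‖ ≤ z.re := by
  have hz' : |Complex.arg z| ≤ θ := hz
  have h1 : Real.cos θ ≤ Real.cos (Complex.arg z) := by
    rw [← Real.cos_abs (Complex.arg z)]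
    exact Real.cos_le_cos_of_nonneg_of_le_pi (abs_nonneg _) hθ hz'
  rw [← Complex.norm_mul_cos_arg z, mul_comm]
  exact mul_le_mul_of_nonneg_left h1 (norm_nonneg _)

/-- No cancellation in a sector: real parts control moduli up to cos θ. -/
lemma hilbertSum_le_of_sector {c : ℕ → ℂ} {θ : ℝ} (h0 : 0 ≤ θ) (hθ : θ < Real.pi / 2)
    (hc : ∀ n, c n ∈ sectorK θ) (n : ℕ) :
    Real.cos θ * hilbertSum c n ≤ ‖∑ i ∈ Finset.range n, c (n + 1 + i) / (i + 1 : ℂ)‖ := by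
  have hpi := Real.pi_pos
  refine le_trans ?_ (Complex.re_le_norm _)
  rw [hilbertSum, Finset.mul_sum, Complex.re_sum]
  refine Finset.sum_le_sum fun i _ => ?_
  have e : (c (n + 1 + i) / (i + 1 : ℂ)).re = (c (n + 1 + i)).re / (i + 1) := by
    rw [show (i + 1 : ℂ) = ((i + 1 : ℝ) : ℂ) by push_cast; rfl, Complex.div_ofReal_re]
  rw [e, ← mul_div_assoc]
  exact div_le_div_of_nonneg_right (sectorK_cos_mul_norm_le (by linarith) (hc _)) (by positivity)

/-- The remainder has no frequencies in [-n, n]. Centring at σn with N ≤ 2n puts one member of each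
pair there, so only the one-sided tail survives. -/
lemma norm_sum_sideCoeff_div_le {f : ℝ → ℂ} (hf : L1Int f) {σ : ℤ} (hσ : σ = 1 ∨ σ = -1)
    {n N : ℕ} (hN : N ≤ 2 * n) :
    ‖∑ i ∈ Finset.range N, sideCoeff f σ (n + 1 + i) / (i + 1 : ℂ)‖
      ≤ (1 + Real.pi) / Real.pi * normL (fun x => f x - fourierPartialSum f n x) := by
  have hS : L1Int (fourierPartialSum f n) := Continuous.l1Int (by fun_prop)
  have hg : L1Int (fun x => f x - fourierPartialSum f n x) := hf.sub hS
  have hcoef : ∀ k : ℤ, fcoeff (fun x => f x - fourierPartialSum f n x) k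
      = if k ∈ Finset.Icc (-(n : ℤ)) (n : ℤ) then 0 else fcoeff f k := by
    intro k
    rw [fcoeff_sub hf hS, fcoeff_fourierPartialSum]
    split_ifs <;> simp
  have h := norm_sum_fcoeff_sub_div_le hg (σ * n) N
  refine le_of_eq_of_le ?_ h
  rcases hσ with rfl | rfl
  · congr 1
    refine Finset.sum_congr rfl fun i hi => ?_
    have := Finset.mem_range.1 hi
    rw [hcoef, hcoef, if_neg (by rw [Finset.mem_Icc]; omega),
      if_pos (by rw [Finset.mem_Icc]; omega), sub_zero, sideCoeff]
    congr 2; push_cast; ring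
  · rw [← norm_neg, ← Finset.sum_neg_distrib]
    congr 1
    refine Finset.sum_congr rfl fun i hi => ?_
    have := Finset.mem_range.1 hi
    rw [hcoef, hcoef, if_pos (by rw [Finset.mem_Icc]; omega),
      if_neg (by rw [Finset.mem_Icc]; omega), zero_sub, sideCoeff, neg_div]
    congr 3; push_cast; ring

/-- Replaces the sector condition by slow variation: freezing c_{n+1+i} at c_n turns the weighted
sum into a harmonic sum times c_n, with error governed by the variation over [n, μn]. -/
lemma tendsto_norm_mul_log_of_smallLogVariation {c : ℕ → ℂ}
    (hvar : SmallLogVariation fun k => ‖c (k + 1) - c k‖) {a : ℕ → ℝ}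
    (ha : Tendsto a atTop (𝓝 0))
    (hca : ∀ n N : ℕ, N ≤ 2 * n →
      ‖∑ i ∈ Finset.range N, c (n + 1 + i) / (i + 1 : ℂ)‖ ≤ a n) :
    Tendsto (fun k : ℕ => ‖c k‖ * Real.log k) atTop (𝓝 0) := by
  rw [Metric.tendsto_atTop']
  intro ε hε
  obtain ⟨μ, hμ1, hμ2, hμ⟩ := hvar (ε / 4) (by positivity)
  have hμ0 : 0 < μ - 1 := by linarith
  obtain ⟨n₁, hn₁⟩ := eventually_atTop.1 hμ
  obtain ⟨n₂, hn₂⟩ := eventually_atTop.1 (ha.eventually (gt_mem_nhds (by positivity : 0 < ε / 4)))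
  -- Makes n ≤ ((μ-1)n)² ≤ (r+1)², so the harmonic sum of length r = N - n is at least half of log
  -- n.
  obtain ⟨n₃, hn₃⟩ := exists_nat_gt (1 / (μ - 1) ^ 2)
  refine ⟨n₁ + n₂ + n₃ + 2, fun n hn => ?_⟩
  rw [Real.dist_eq, sub_zero, abs_of_nonneg (mul_nonneg (norm_nonneg _) (Real.log_natCast_nonneg n))]
  have hn2 : (2 : ℝ) ≤ n := by exact_mod_cast (by omega : 2 ≤ n)
  have hlog0 : 0 < Real.log n := Real.log_pos (by linarith)
  have hn3 : 1 < (μ - 1) ^ 2 * n := by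
    rw [div_lt_iff₀ (by positivity)] at hn₃
    have h1 : (n₃ : ℝ) ≤ n := by exact_mod_cast (by omega : n₃ ≤ n)
    nlinarith [sq_nonneg (μ - 1)]
  set N : ℕ := ⌊μ * (n : ℝ)⌋₊ with hN
  have hNle : (N : ℝ) ≤ μ * n := Nat.floor_le (by positivity)
  have hNlt : μ * n < N + 1 := Nat.lt_floor_add_one _
  have hnN : n ≤ N := Nat.le_floor (by nlinarith)
  have hN2n : N ≤ 2 * n := by
    have : (N : ℝ) ≤ 2 * n := by nlinarith
    exact_mod_cast this
  obtain ⟨r, hr⟩ := Nat.exists_eq_add_of_le hnN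
  have hrN : (N : ℝ) = n + r := by rw [hr]; push_cast; ring
  set V := ∑ k ∈ Finset.Icc n N, ‖c (k + 1) - c k‖ with hV
  have hVlog : V * Real.log n ≤ ε / 4 := by
    refine le_trans ?_ (hn₁ n (by omega))
    have := sum_Ico_mul_log_le (v := fun k => ‖c (k + 1) - c k‖) (fun k => norm_nonneg _)
      (n := n) (a := n) (b := N + 1) (N := N) (by omega) le_rfl le_rfl
    rwa [Finset.Ico_add_one_right_eq_Icc] at this
  set H := ∑ i ∈ Finset.range r, 1 / ((i : ℝ) + 1) with hH
  have hHlog : Real.log n ≤ 2 * H := by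
    refine (log_le_two_mul_log (b := r + 1) (by linarith) ?_).trans
      (mul_le_mul_of_nonneg_left (log_le_sum_inv r) zero_le_two)
    have h1 : (μ - 1) * n ≤ r + 1 := by linarith
    have h2 : ((μ - 1) * n) ^ 2 ≤ ((r : ℝ) + 1) ^ 2 := by gcongr
    nlinarith
  have hHpos : 0 < H := by linarith
  have hkey : H * ‖c n‖ ≤ ε / 4 + H * V := by
    have hid : (H : ℂ) * c n = ∑ i ∈ Finset.range r, c (n + 1 + i) / (i + 1 : ℂ)
        - ∑ i ∈ Finset.range r, (c (n + 1 + i) - c n) / (i + 1 : ℂ) := by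
      rw [← Finset.sum_sub_distrib, hH, Complex.ofReal_sum, Finset.sum_mul]
      refine Finset.sum_congr rfl fun i _ => ?_
      push_cast; ring
    have h1 : H * ‖c n‖ = ‖(H : ℂ) * c n‖ := by
      rw [norm_mul, Complex.norm_real, Real.norm_eq_abs, abs_of_pos hHpos]
    rw [h1, hid]
    refine (norm_sub_le _ _).trans (add_le_add ((hca n r (by omega)).trans (hn₂ n (by omega)).le) ?_)
    refine (norm_sum_le _ _).trans ?_
    rw [hH, Finset.sum_mul]
    refine Finset.sum_le_sum fun i hi => ?_
    have hi' := Finset.mem_range.1 hi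
    have h2 : ‖(i + 1 : ℂ)‖ = i + 1 := by
      rw [show (i + 1 : ℂ) = ((i + 1 : ℕ) : ℂ) by push_cast; rfl, Complex.norm_natCast]
      push_cast; rfl
    rw [norm_div, h2, div_mul_eq_mul_div, one_mul]
    exact div_le_div_of_nonneg_right
      (norm_sub_le_sum_norm_sub c (by omega) (by omega)) (by positivity)
  have hfin : H * (‖c n‖ * Real.log n) ≤ H * (3 * ε / 4) := by
    nlinarith
  have := le_of_mul_le_mul_left hfin hHpos
  linarith

/-! ### Unpacking the hypotheses and the final equivalence. -/

lemma smallLogVariation_of_tendsto_limsup {v : ℕ → ℝ}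
    (h : Tendsto (fun μ : ℝ => limsup (fun n : ℕ => ENNReal.ofReal
      (∑ k ∈ Finset.Icc n ⌊μ * (n : ℝ)⌋₊, v k * Real.log (k : ℝ))) atTop)
      (𝓝[>] (1 : ℝ)) (𝓝 0)) : SmallLogVariation v := by
  intro η hη
  have h1 := h.eventually (gt_mem_nhds (ENNReal.ofReal_pos.2 hη))
  have h2 : ∀ᶠ μ : ℝ in 𝓝[>] 1, μ ∈ Set.Ioo (1 : ℝ) 2 := Ioo_mem_nhdsGT (by norm_num)
  obtain ⟨μ, hμ, hμ1, hμ2⟩ := (h1.and h2).exists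
  refine ⟨μ, hμ1, hμ2.le, ?_⟩
  filter_upwards [eventually_lt_of_limsup_lt hμ] with n hn
  exact ((ENNReal.ofReal_lt_ofReal_iff hη).1 hn).le

lemma SmallLogVariation.mono {v w : ℕ → ℝ} (hw : SmallLogVariation w) (h : ∀ k, v k ≤ w k) :
    SmallLogVariation v := by
  intro η hη
  obtain ⟨μ, h1, h2, h3⟩ := hw η hη
  refine ⟨μ, h1, h2, h3.mono fun n hn => (Finset.sum_le_sum fun k _ => ?_).trans hn⟩
  exact mul_le_mul_of_nonneg_right (h k) (Real.log_natCast_nonneg k)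

/-- Because μ ≤ 2, the sum of u lies within the dyadic block [n, 2n], where log k ≤ 2 log n. -/
lemma SmallLogVariation.add_of_tendsto {u v : ℕ → ℝ} (hu0 : ∀ k, 0 ≤ u k)
    (hu : Tendsto (fun m : ℕ => Real.log m * ∑ k ∈ Finset.Icc m (2 * m), u k) atTop (𝓝 0))
    (hv : SmallLogVariation v) : SmallLogVariation fun k => u k + v k := by
  intro η hη
  obtain ⟨μ, h1, h2, h3⟩ := hv (η / 2) (half_pos hη)
  refine ⟨μ, h1, h2, ?_⟩
  filter_upwards [h3, hu.eventually (gt_mem_nhds (by positivity : 0 < η / 4)),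
    eventually_ge_atTop 2] with n hn hun hn2
  have hn2' : (2 : ℝ) ≤ n := by exact_mod_cast hn2
  have hN : ⌊μ * (n : ℝ)⌋₊ ≤ 2 * n := by
    refine Nat.floor_le_of_le ?_
    push_cast
    nlinarith
  have hmain : ∑ k ∈ Finset.Icc n ⌊μ * (n : ℝ)⌋₊, u k * Real.log k
      ≤ ∑ k ∈ Finset.Icc n (2 * n), u k * (2 * Real.log n) := by
    refine (Finset.sum_le_sum_of_subset_of_nonneg (Finset.Icc_subset_Icc le_rfl hN)
      fun k _ _ => mul_nonneg (hu0 k) (Real.log_natCast_nonneg k)).trans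
      (Finset.sum_le_sum fun k hk => mul_le_mul_of_nonneg_left ?_ (hu0 k))
    rw [Finset.mem_Icc] at hk
    refine log_le_two_mul_log (by exact_mod_cast (by omega : 0 < k)) ?_
    have : (k : ℝ) ≤ 2 * n := by exact_mod_cast hk.2
    nlinarith
  rw [← Finset.sum_mul] at hmain
  simp only [add_mul, Finset.sum_add_distrib]
  nlinarith

lemma tendsto_fcoeff_mul_log_iff (f : ℝ → ℂ) :
    Tendsto (fun n : ℤ => fcoeff f n * ((Real.log |(n : ℝ)| : ℝ) : ℂ))
      (comap (fun n : ℤ => |n|) atTop) (𝓝 0) ↔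
    Tendsto (fun k : ℕ => ‖sideCoeff f 1 k‖ * Real.log k) atTop (𝓝 0) ∧
      Tendsto (fun k : ℕ => ‖sideCoeff f (-1) k‖ * Real.log k) atTop (𝓝 0) := by
  have hneg : (atBot : Filter ℤ) = map (fun k : ℕ => -(k : ℤ)) atTop := by
    rw [← Filter.map_neg_atTop, ← Nat.map_cast_int_atTop, Filter.map_map]; rfl
  rw [comap_abs_atTop, tendsto_sup, hneg, ← Nat.map_cast_int_atTop, tendsto_map'_iff,
    tendsto_map'_iff, and_comm, tendsto_zero_iff_norm_tendsto_zero]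
  refine and_congr (iff_of_eq ?_) ((tendsto_zero_iff_norm_tendsto_zero).trans (iff_of_eq ?_)) <;>
  · congr 1
    ext k
    simp [sideCoeff, -Complex.natCast_log, Real.log_natCast_nonneg k]

theorem theorem1 (f : ℝ → ℂ)
    (hper : Function.Periodic f (2 * Real.pi))
    (hint : IntervalIntegrable f MeasureTheory.volume (-Real.pi) Real.pi)
    (hmv : (fun n : ℕ => fcoeff f (n : ℤ)) ∈ MVBVS)
    (hdelta : Tendsto
      (fun μ : ℝ => limsup
        (fun n : ℕ => ENNReal.ofReal
          (∑ k ∈ Finset.Icc n ⌊μ * (n : ℝ)⌋₊,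
            ‖deltaPos f k - deltaNeg f k‖ * Real.log (k : ℝ))) atTop)
      (𝓝[>] (1 : ℝ)) (𝓝 0)) :
    Tendsto (fun n : ℕ => normL (fun x => f x - fourierPartialSum f n x)) atTop (𝓝 0) ↔
      Tendsto (fun n : ℤ => fcoeff f n * ((Real.log |(n : ℝ)| : ℝ) : ℂ))
        (comap (fun n : ℤ => |n|) atTop) (𝓝 0) := by
  have hpi := Real.pi_pos
  have hside : (fun n : ℕ => fcoeff f (n : ℤ)) = sideCoeff f 1 := by
    ext k; simp [sideCoeff]
  rw [hside] at hmv
  obtain ⟨⟨θ, hθ0, hθ, hsec⟩, lam, hlam, C, -, hmvb⟩ := hmv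
  have hmvb : MeanValueBoundedVariation (sideCoeff f 1) lam C := hmvb
  have hv := smallLogVariation_of_tendsto_limsup hdelta
  have htri : ∀ k, ‖deltaNeg f k‖ ≤ ‖deltaPos f k‖ + ‖deltaPos f k - deltaNeg f k‖ := fun k => by
    simpa using norm_sub_le (deltaPos f k) (deltaPos f k - deltaNeg f k)
  have hposvar (ha : Tendsto (logAverage (sideCoeff f 1) lam) atTop (𝓝 0)) :
      Tendsto (fun m : ℕ => Real.log m * ∑ k ∈ Finset.Icc m (2 * m), ‖deltaPos f k‖)
        atTop (𝓝 0) := by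
    simpa only [deltaPos_eq] using hmvb.tendsto_log_mul_variation ha
  rw [tendsto_fcoeff_mul_log_iff]
  constructor
  · intro hconv
    have hbound : Tendsto (fun n => (1 + Real.pi) / Real.pi *
        normL (fun x => f x - fourierPartialSum f n x)) atTop (𝓝 0) := by
      simpa using hconv.const_mul ((1 + Real.pi) / Real.pi)
    have hcos : 0 < Real.cos θ := Real.cos_pos_of_mem_Ioo ⟨by linarith, hθ⟩
    have hT : Tendsto (hilbertSum (sideCoeff f 1)) atTop (𝓝 0) := by
      have h1 := hbound.const_mul (Real.cos θ)⁻¹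
      rw [mul_zero] at h1
      refine squeeze_zero (fun n => Finset.sum_nonneg fun i _ => by positivity) (fun n => ?_) h1
      rw [inv_mul_eq_div, le_div_iff₀ hcos, mul_comm]
      exact (hilbertSum_le_of_sector hθ0 hθ hsec n).trans
        (norm_sum_sideCoeff_div_le hint (Or.inl rfl) (by omega))
    have ha := tendsto_logAverage_of_hilbertSum hlam hT
    refine ⟨tendsto_norm_mul_log_of_logAverage hlam hmvb ha, ?_⟩
    refine tendsto_norm_mul_log_of_smallLogVariation (SmallLogVariation.mono
      (SmallLogVariation.add_of_tendsto (fun k => norm_nonneg _) (hposvar ha) hv) fun k => ?_)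
      hbound fun n N hN => norm_sum_sideCoeff_div_le hint (Or.inr rfl) hN
    rw [← deltaNeg_eq]
    exact htri k
  · rintro ⟨hpos, hneg⟩
    have hu := hposvar (tendsto_logAverage_of_tendsto hlam hpos)
    -- The positive variation is counted twice: for itself and within the bound `htri` for the
    -- negative one.
    refine tendsto_normL_sub_fourierPartialSum hint hpos hneg (SmallLogVariation.mono
      (SmallLogVariation.add_of_tendsto (fun k => norm_nonneg _) hu
        (SmallLogVariation.add_of_tendsto (fun k => norm_nonneg _) hu hv)) fun k => ?_)
    linarith [htri k]
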